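/- Let $A$ and $B$ be $C^*$-algebras, $X$ a (right) Hilbert $C^*$-module over $A$, $Y$ a (right) Hilbert $C^*$-module over $B$, and let $D:\mathrm{Dom}(D)\to Y$ be an unbounded selfadjoint and regular operator on $Y$. Let $\rho:A\to\mathcal L(Y)$ be an injective $*$-homomorphism into the $C^*$-algebra of bounded adjointable operators, and $\mathcal A\subseteq A$ a dense $*$-subalgebra such that, for all $a\in\mathcal A$, $\rho(a)$ maps $\mathrm{Dom}(D)$ to itself and $[D,\rho(a)]:\mathrm{Dom}(D)\to Y$ extends to a bounded adjointable operator $\delta(a)\in\mathcal L(Y)$. Suppose that there is a sequence $(\xi_n)$ in $X$ whose $A$-span is dense in $X$ and with $\langle\xi_n,\xi_m\rangle\in\mathcal A$ for all $n,m$. Notation. For a Hilbert module $E$ over a $C^*$-algebra $C$, $E^\infty$ is the Hilbert $C$-module of sequences $(e_n)$ in $E$ for which $\sum_n\langle e_n,e_n\rangle$ converges in norm; $H_C:=C^\infty$ is the standard module, and $\mathcal K(H_C)$ is the algebra of compact operators on it. $A_\delta\subseteq A$ is the completion of $\mathcal A$ in the norm $\|a\|+\|\delta(a)\|$, to which $\delta$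 extends (this derivation is closable). $H_{A_\delta}$ is the set of $(a_n)\in H_A$ with $a_n\in A_\delta$ and $(\delta(a_n))\in H_{\mathcal L(Y)}$. $\mathcal K(H_A)_\delta\subseteq\mathcal K(H_A)$ is the completion of the finite matrices $m$ over $\mathcal A$ in the norm $\|m\|+\|\delta(m)\|$, with $\delta$ applied entrywise and $\delta(m)$ acting on $H_{\mathcal L(Y)}$. $\Omega_\delta(A)\subseteq\mathcal L(Y)$ is the smallest $C^*$-subalgebra containing $\rho(a)$ and $\delta(a)$ for all $a\in A_\delta$; it is a Hilbert module over itself on which $A$ acts by left multiplication through $\rho$. $\hat\otimes_A$ is the interior tensor product of Hilbert modules. Let $W:X\to H_A$ be a bounded adjointable isometry ($W^*W=1$) and $K:H_A\to H_A$ a positive bounded adjointable operator such that, with $P=WW^*$: (1) $KP=PK$; (2) $W^*KW:X\to X$ has dense image; (3) $PK\in\mathcal K(H_A)$; (4) $PK^2\in\mathcal K(H_A)_\delta$. Let $(\zeta_k)$ be a sequence in $X$ with $W(\xi)=(\langle\zeta_k,\xi\rangle)_k$ for all $\xi\in X$. Put $\mathcal X:=W^*K^2(H_{A_\delta})\subseteq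 X$. Let $W\otimes1:X\hat\otimes_AY\to Y^\infty$ be the bounded operator $\xi\otimes\eta\mapsto(\rho(W(\xi)_k)\eta)_k$, and let $W\otimes 1:X\hat\otimes_A\Omega_\delta(A)\to H_{\Omega_\delta(A)}$ be defined likewise. Let $\mathrm{diag}(D)$ be the operator $(\eta_k)\mapsto(D\eta_k)$ on $Y^\infty$ with domain the set of $(\eta_k)\in Y^\infty$ with $\eta_k\in\mathrm{Dom}(D)$ and $(D\eta_k)\in Y^\infty$. Then both operators $W\otimes1$ are adjointable. Write $W^*\otimes1$ for their adjoints, let the symmetric lift be $$1\otimes_\nabla D:=(W^*\otimes1)\,\mathrm{diag}(D)\,(W\otimes1),\qquad \mathrm{Dom}(1\otimes_\nabla D)=\{\sigma\in X\hat\otimes_AY:(W\otimes1)\sigma\in\mathrm{Dom}(\mathrm{diag}(D))\},$$ and let the Grassmann connection be $\nabla_\delta(\xi):=(W^*\otimes1)\big((\delta(W(\xi)_k))_k\big)\in X\hat\otimes_A\Omega_\delta(A)$. Then: (a) $\mathrm{Dom}(1\otimes_\nabla D)$ is a right $B$-submodule, on which $1\otimes_\nabla D$ is $B$-linear, and it is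 dense in $X\hat\otimes_AY$. (b) $1\otimes_\nabla D$ is symmetric: $\langle(1\otimes_\nabla D)\sigma,\tau\rangle=\langle\sigma,(1\otimes_\nabla D)\tau\rangle$ for all $\sigma,\tau\in\mathrm{Dom}(1\otimes_\nabla D)$. (c) For all $\xi\in\mathcal X$ and $\eta\in\mathrm{Dom}(D)$: $\nabla_\delta(\xi)$ is defined, $\xi\otimes\eta\in\mathrm{Dom}(1\otimes_\nabla D)$, and $$(1\otimes_\nabla D)(\xi\otimes\eta)=\nabla_\delta(\xi)(\eta)+\xi\otimes D\eta,$$ where $\tau\mapsto\tau(\eta)$, $X\hat\otimes_A\Omega_\delta(A)\to X\hat\otimes_AY$, is the bounded linear map with $(\xi\otimes\omega)(\eta)=\xi\otimes\omega(\eta)$. -/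

import Mathlib

noncomputable section

open scoped ComplexOrder TensorProduct
open MulOpposite

set_option linter.unusedSectionVars false

namespace SymLift

/-! ### Right Hilbert C⋆-modules

Mathlib's `CStarModule A E` has an `A`-valued inner product with `⟪x, a • y⟫ = a * ⟪x, y⟫`.
Hence a (right) Hilbert `B`-module is a `CStarModule Bᵐᵒᵖ Y`: the right action is `y · b = op b • y`,
and after applying `unop` the inner product satisfies `⟪x, y · b⟫ = ⟪x, y⟫ b`. -/

section Inner

variable (B : Type*) {E F : Type*} [NonUnitalCStarAlgebra B] [PartialOrder B] [StarOrderedRing B]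
  [NormedAddCommGroup E] [NormedSpace ℂ E] [SMul Bᵐᵒᵖ E] [CStarModule Bᵐᵒᵖ E]
  [NormedAddCommGroup F] [NormedSpace ℂ F] [SMul Bᵐᵒᵖ F] [CStarModule Bᵐᵒᵖ F]

/-- The `B`-valued inner product of a right Hilbert `B`-module, conjugate linear in the first and
linear in the second variable, with `⟪x, y · b⟫ = ⟪x, y⟫ b`. -/
def rinner (x y : E) : B := unop (inner Bᵐᵒᵖ x y)

variable {B}

lemma rinner_add_right (x y z : E) : rinner B x (y + z) = rinner B x y + rinner B x z := by
  simp [rinner]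

lemma rinner_add_left (x y z : E) : rinner B (x + y) z = rinner B x z + rinner B y z := by
  simp [rinner]

lemma rinner_sub_right (x y z : E) : rinner B x (y - z) = rinner B x y - rinner B x z := by
  simp [rinner]

lemma rinner_sub_left (x y z : E) : rinner B (x - y) z = rinner B x z - rinner B y z := by
  simp [rinner]

lemma rinner_smul_right (c : ℂ) (x y : E) : rinner B x (c • y) = c • rinner B x y := by
  simp [rinner]

lemma rinner_smul_left (c : ℂ) (x y : E) : rinner B (c • x) y = star c • rinner B x y := by
  simp [rinner]

lemma rinner_sum_right {ι : Type*} (s : Finset ι) (x : E) (y : ι → E) :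
    rinner B x (∑ i ∈ s, y i) = ∑ i ∈ s, rinner B x (y i) := by
  simp [rinner, Finset.unop_sum]

lemma rinner_sum_left {ι : Type*} (s : Finset ι) (x : ι → E) (y : E) :
    rinner B (∑ i ∈ s, x i) y = ∑ i ∈ s, rinner B (x i) y := by
  simp [rinner, Finset.unop_sum]

lemma rinner_act_right (b : B) (x y : E) : rinner B x (op b • y) = rinner B x y * b := by
  simp [rinner]

lemma rinner_act_left (b : B) (x y : E) : rinner B (op b • x) y = star b * rinner B x y := by
  simp [rinner]

lemma star_rinner (x y : E) : star (rinner B x y) = rinner B y x := by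
  simp [rinner, ← unop_star]

lemma rinner_self_nonneg (x : E) : 0 ≤ rinner B x x :=
  CStarModule.inner_self_nonneg (A := Bᵐᵒᵖ) (x := x)

lemma rinner_self_eq_zero {x : E} : rinner B x x = 0 ↔ x = 0 := by
  simp [rinner, CStarModule.inner_self]

lemma norm_rinner_le (x y : E) : ‖rinner B x y‖ ≤ ‖x‖ * ‖y‖ :=
  CStarModule.norm_inner_le (A := Bᵐᵒᵖ) E (x := x) (y := y)

lemma norm_sq_rinner (x : E) : ‖x‖ ^ 2 = ‖rinner B x x‖ :=
  CStarModule.norm_sq_eq Bᵐᵒᵖ (x := x)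

@[fun_prop]
lemma continuous_rinner : Continuous fun p : E × E => rinner B p.1 p.2 :=
  continuous_unop.comp (CStarModule.continuous_inner (A := Bᵐᵒᵖ))

lemma ext_rinner {x y : E} (h : ∀ z : E, rinner B x z = rinner B y z) : x = y := by
  rw [← sub_eq_zero, ← rinner_self_eq_zero (B := B), rinner_sub_left, h, sub_self]

lemma ext_rinner' {x y : E} (h : ∀ z : E, rinner B z x = rinner B z y) : x = y :=
  ext_rinner (B := B) fun z => by rw [← star_rinner, h, star_rinner]

lemma act_add (b : B) (x y : E) : op b • (x + y) = op b • x + op b • y :=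
  ext_rinner' (B := B) fun z => by simp [rinner_act_right, rinner_add_right, add_mul]

lemma act_smul (b : B) (c : ℂ) (x : E) : op b • (c • x) = c • (op b • x) :=
  ext_rinner' (B := B) fun z => by simp [rinner_act_right, rinner_smul_right, smul_mul_assoc]

lemma norm_act_le (b : B) (x : E) : ‖op b • x‖ ≤ ‖b‖ * ‖x‖ := by
  rw [← sq_le_sq₀ (by positivity) (by positivity), norm_sq_rinner (B := B), rinner_act_right,
    rinner_act_left, mul_pow, norm_sq_rinner (B := B) x]
  calc ‖star b * rinner B x x * b‖ ≤ ‖star b‖ * ‖rinner B x x‖ * ‖b‖ := by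
        refine (norm_mul_le _ _).trans ?_
        gcongr
        exact norm_mul_le _ _
    _ = _ := by rw [norm_star]; ring

variable (B) in
/-- `S` is an adjoint of `T`. -/
def IsAdjointPair (T : E → F) (S : F → E) : Prop :=
  ∀ x y, rinner B (T x) y = rinner B x (S y)

open Classical in
variable (B) in
/-- The (unique) adjoint of an adjointable operator `T` between Hilbert modules; by convention `0`
when `T` has no bounded adjoint. -/
def adjointOf (T : E →L[ℂ] F) : F →L[ℂ] E :=
  if h : ∃ S : F →L[ℂ] E, IsAdjointPair B T S then h.choose else 0

lemma IsAdjointPair.symm {T : E → F} {S : F → E} (h : IsAdjointPair B T S) :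
    IsAdjointPair B S T := fun x y => by
  rw [← star_rinner, ← h, star_rinner]

lemma IsAdjointPair.ext {T : E → F} {S S' : F → E} (h : IsAdjointPair B T S)
    (h' : IsAdjointPair B T S') : S = S' := by
  funext y
  exact ext_rinner' (B := B) fun z => by rw [← h, h']

end Inner

/-! ### The C⋆-algebra of bounded adjointable operators -/

section Adjointable

variable (B E : Type*) [NonUnitalCStarAlgebra B] [PartialOrder B] [StarOrderedRing B]
  [NormedAddCommGroup E] [NormedSpace ℂ E] [SMul Bᵐᵒᵖ E] [CStarModule Bᵐᵒᵖ E]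

/-- The bounded adjointable operators on a Hilbert module, as a subalgebra of the bounded operators
(with the operator norm). -/
def adjointableSubalgebra : Subalgebra ℂ (E →L[ℂ] E) where
  carrier := {T | ∃ S : E →L[ℂ] E, IsAdjointPair B T S}
  mul_mem' := by
    rintro T T' ⟨S, hS⟩ ⟨S', hS'⟩
    exact ⟨S' * S, fun x y => by simp [hS _ _, hS' _ _]⟩
  add_mem' := by
    rintro T T' ⟨S, hS⟩ ⟨S', hS'⟩
    exact ⟨S + S', fun x y => by
      simp [hS _ _, hS' _ _, rinner_add_left, rinner_add_right]⟩
  algebraMap_mem' c := ⟨algebraMap ℂ _ (star c), fun x y => by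
    simp [Algebra.algebraMap_eq_smul_one, rinner_smul_left, rinner_smul_right]⟩

/-- The C⋆-algebra `ℒ(E)` of bounded adjointable operators on the Hilbert `B`-module `E`. -/
abbrev Adj : Type _ := adjointableSubalgebra B E

variable {B E}

instance : Star (Adj B E) :=
  ⟨fun T => ⟨T.2.choose, T.1, T.2.choose_spec.symm⟩⟩

/-- Application of an adjointable operator to a vector. -/
abbrev Adj.app (T : Adj B E) (x : E) : E := (T : E →L[ℂ] E) x

lemma Adj.adjoint (T : Adj B E) (x y : E) :
    rinner B (T.app x) y = rinner B x ((star T).app y) :=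
  T.2.choose_spec x y

lemma Adj.adjoint' (T : Adj B E) (x y : E) :
    rinner B x (T.app y) = rinner B ((star T).app x) y := by
  rw [← star_rinner, T.adjoint, star_rinner]

lemma Adj.ext' {S T : Adj B E} (h : ∀ x y, rinner B x (S.app y) = rinner B x (T.app y)) : S = T := by
  apply Subtype.ext
  ext y
  exact ext_rinner' (B := B) fun x => h x y

instance : StarRing (Adj B E) where
  star_involutive T := Adj.ext' fun x y => by rw [← Adj.adjoint, ← Adj.adjoint']
  star_mul S T := Adj.ext' fun x y => by
    rw [← Adj.adjoint]
    change rinner B (S.app (T.app x)) y = rinner B x ((star T).app ((star S).app y))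
    rw [Adj.adjoint, Adj.adjoint]
  star_add S T := Adj.ext' fun x y => by
    rw [← Adj.adjoint]
    change rinner B (S.app x + T.app x) y = rinner B x ((star S).app y + (star T).app y)
    rw [rinner_add_left, rinner_add_right, Adj.adjoint, Adj.adjoint]

instance : StarModule ℂ (Adj B E) where
  star_smul c T := Adj.ext' fun x y => by
    rw [← Adj.adjoint]
    change rinner B (c • T.app x) y = rinner B x (star c • (star T).app y)
    rw [rinner_smul_left, rinner_smul_right, Adj.adjoint]

lemma Adj.norm_mul_self_le (T : Adj B E) : ‖T‖ * ‖T‖ ≤ ‖star T * T‖ := by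
  have key : ‖T‖ ≤ √‖star T * T‖ := by
    refine ContinuousLinearMap.opNorm_le_bound _ (Real.sqrt_nonneg _) fun x => ?_
    rw [← sq_le_sq₀ (by positivity) (by positivity), mul_pow, Real.sq_sqrt (norm_nonneg (star T * T)),
      norm_sq_rinner (B := B)]
    have h1 : rinner B (T.app x) (T.app x) = rinner B x ((star T * T).app x) := Adj.adjoint T x _
    change ‖rinner B (T.app x) (T.app x)‖ ≤ _
    rw [h1]
    calc _ ≤ ‖x‖ * ‖(star T * T).app x‖ := norm_rinner_le _ _
      _ ≤ ‖x‖ * (‖star T * T‖ * ‖x‖) := by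
        gcongr
        exact ContinuousLinearMap.le_opNorm _ _
      _ = _ := by ring
  calc ‖T‖ * ‖T‖ ≤ √‖star T * T‖ * √‖star T * T‖ := by gcongr
    _ = _ := Real.mul_self_sqrt (norm_nonneg _)

instance : CStarRing (Adj B E) := ⟨Adj.norm_mul_self_le⟩

lemma Adj.isClosed [CompleteSpace E] :
    IsClosed (adjointableSubalgebra B E : Set (E →L[ℂ] E)) := by
  refine IsSeqClosed.isClosed fun T T₀ hT hlim => ?_
  let T' : ℕ → Adj B E := fun n => ⟨T n, hT n⟩
  have hC : CauchySeq fun n => ((star (T' n) : Adj B E) : E →L[ℂ] E) := by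
    have h1 : CauchySeq T := hlim.cauchySeq
    rw [Metric.cauchySeq_iff] at h1 ⊢
    intro ε hε
    obtain ⟨N, hN⟩ := h1 ε hε
    refine ⟨N, fun m hm n hn => ?_⟩
    have h2 := hN m hm n hn
    rw [dist_eq_norm] at h2 ⊢
    have h3 : ‖star (T' m - T' n)‖ = ‖T' m - T' n‖ := norm_star (T' m - T' n)
    rw [star_sub] at h3
    exact h3.trans_lt h2
  obtain ⟨S₀, hS₀⟩ := cauchySeq_tendsto_of_complete hC
  refine ⟨S₀, fun x y => ?_⟩
  have e1 : Filter.Tendsto (fun n => rinner B (T n x) y) Filter.atTop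
      (nhds (rinner B (T₀ x) y)) :=
    ((continuous_rinner (B := B)).tendsto (T₀ x, y)).comp
      ((((ContinuousLinearMap.apply ℂ E x).continuous.tendsto T₀).comp hlim).prodMk_nhds
        tendsto_const_nhds)
  have e2 : Filter.Tendsto (fun n => rinner B x ((star (T' n)).app y)) Filter.atTop
      (nhds (rinner B x (S₀ y))) :=
    ((continuous_rinner (B := B)).tendsto (x, S₀ y)).comp
      (tendsto_const_nhds.prodMk_nhds
        (((ContinuousLinearMap.apply ℂ E y).continuous.tendsto S₀).comp hS₀))
  refine tendsto_nhds_unique e1 (e2.congr fun n => ?_)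
  exact (Adj.adjoint (T' n) x y).symm

instance [CompleteSpace E] : CompleteSpace (Adj B E) := Adj.isClosed.completeSpace_coe

instance [CompleteSpace E] : CStarAlgebra (Adj B E) where

/-- The usual order of the C⋆-algebra `ℒ(E)`. -/
instance [CompleteSpace E] : PartialOrder (Adj B E) := CStarAlgebra.spectralOrder _

instance [CompleteSpace E] : StarOrderedRing (Adj B E) := CStarAlgebra.spectralOrderedRing _

end Adjointable

/-! ### A C⋆-algebra as a Hilbert module over itself -/

section Self

variable {C : Type*} [NonUnitalCStarAlgebra C] [PartialOrder C] [StarOrderedRing C]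

/-- A C⋆-algebra is a right Hilbert module over itself, with `⟪x, y⟫ = x⋆ y` and `x · a = x a`. -/
instance : CStarModule Cᵐᵒᵖ C where
  inner x y := op (star x * y)
  inner_add_right := by simp [mul_add]
  inner_self_nonneg {x} := star_mul_self_nonneg x
  inner_self {x} := by simp
  inner_op_smul_right {a x y} := by simp [mul_assoc]
  inner_smul_right_complex {z x y} := by simp [smul_mul_assoc]
  star_inner x y := by simp [← op_star]
  norm_eq_sqrt_norm_inner_self x := by
    rw [norm_op, CStarRing.norm_star_mul_self, Real.sqrt_mul_self (norm_nonneg _)]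

lemma rinner_self_def (x y : C) : rinner C x y = star x * y := rfl

/-- Left multiplication, as a `⋆`-homomorphism from `C` to `ℒ(C)`. -/
def leftMul : C →⋆ₙₐ[ℂ] Adj C C where
  toFun a := ⟨ContinuousLinearMap.mul ℂ C a, ContinuousLinearMap.mul ℂ C (star a), fun x y => by
    simp [rinner_self_def, mul_assoc]⟩
  map_smul' c a := by apply Subtype.ext; ext x; simp
  map_zero' := by apply Subtype.ext; ext x; simp
  map_add' a b := by apply Subtype.ext; ext x; simp
  map_mul' a b := by apply Subtype.ext; ext x; simp [mul_assoc]
  map_star' a := Adj.ext' fun x y => by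
    rw [← Adj.adjoint]
    simp [rinner_self_def, mul_assoc, Adj.app]

end Self

/-! ### Square summable sequences in a Hilbert module -/

section Std

variable (B Y : Type*) [NonUnitalCStarAlgebra B] [PartialOrder B] [StarOrderedRing B]
  [NormedAddCommGroup Y] [NormedSpace ℂ Y] [SMul Bᵐᵒᵖ Y] [CStarModule Bᵐᵒᵖ Y]

variable {B Y}

lemma summable_of_nonneg_le {a b : ℕ → B} (h0 : ∀ n, 0 ≤ a n) (hab : ∀ n, a n ≤ b n)
    (hb : Summable b) : Summable a := by
  rw [summable_iff_vanishing_norm] at hb ⊢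
  intro ε hε
  obtain ⟨s, hs⟩ := hb ε hε
  refine ⟨s, fun t ht => (CStarAlgebra.norm_le_norm_of_nonneg_of_le
    (Finset.sum_nonneg fun n _ => h0 n) (Finset.sum_le_sum fun n _ => hab n)).trans_lt (hs t ht)⟩

lemma rinner_add_self_le (x y : Y) :
    rinner B (x + y) (x + y) ≤ (2 : ℂ) • (rinner B x x + rinner B y y) := by
  have h := rinner_self_nonneg (B := B) (x - y)
  rw [← sub_nonneg]
  convert h using 1
  simp only [rinner_add_left, rinner_add_right, rinner_sub_left, rinner_sub_right, two_smul]
  abel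

lemma norm_sum_rinner_sq_le (s : Finset ℕ) (x y : ℕ → Y) :
    ‖∑ n ∈ s, rinner B (x n) (y n)‖ ^ 2 ≤
      ‖∑ n ∈ s, rinner B (x n) (x n)‖ * ‖∑ n ∈ s, rinner B (y n) (y n)‖ := by
  have key : ∀ u v : ℕ → Y, ‖∑ n ∈ s, rinner B (u n) (v n)‖ =
      ‖inner Bᵐᵒᵖ ((WithCStarModule.equiv Bᵐᵒᵖ (s → Y)).symm fun n => u n)
        ((WithCStarModule.equiv Bᵐᵒᵖ (s → Y)).symm fun n => v n)‖ := by
    intro u v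
    rw [WithCStarModule.pi_inner, ← norm_unop, ← Finset.sum_coe_sort, Finset.unop_sum]
    rfl
  rw [key, key, key, ← CStarModule.norm_sq_eq Bᵐᵒᵖ, ← CStarModule.norm_sq_eq Bᵐᵒᵖ, ← mul_pow]
  gcongr
  exact CStarModule.norm_inner_le _

lemma summable_rinner {x y : ℕ → Y} (hx : Summable fun n => rinner B (x n) (x n))
    (hy : Summable fun n => rinner B (y n) (y n)) :
    Summable fun n => rinner B (x n) (y n) := by
  rw [summable_iff_vanishing_norm] at hx hy ⊢
  intro ε hε
  obtain ⟨s, hs⟩ := hx ε hε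
  obtain ⟨s', hs'⟩ := hy ε hε
  refine ⟨s ∪ s', fun t ht => ?_⟩
  rw [Finset.disjoint_union_right] at ht
  refine lt_of_pow_lt_pow_left₀ 2 hε.le ((norm_sum_rinner_sq_le t x y).trans_lt ?_)
  rw [sq]
  exact mul_lt_mul'' (hs t ht.1) (hs' t ht.2) (norm_nonneg _) (norm_nonneg _)

variable (B Y)

/-- The sequences `η` in `Y` for which `∑ ⟪η n, η n⟫` converges in norm. (The terms are positive, so
convergence of the partial sums and summability are the same.) -/
def stdSubmodule : Submodule ℂ (ℕ → Y) where
  carrier := {η | Summable fun n => rinner B (η n) (η n)}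
  zero_mem' := by
    have : (fun n : ℕ => rinner B ((0 : ℕ → Y) n) ((0 : ℕ → Y) n)) = 0 := by
      funext n; simp [rinner]
    simp only [Set.mem_ofPred_eq, this]
    exact summable_zero
  add_mem' {x y} hx hy :=
    summable_of_nonneg_le (fun n => rinner_self_nonneg _) (fun n => rinner_add_self_le _ _)
      ((Summable.add hx hy).const_smul (2 : ℂ))
  smul_mem' c x hx := by
    have : (fun n : ℕ => rinner B ((c • x) n) ((c • x) n)) =
        fun n => (star c * c) • rinner B (x n) (x n) := by
      funext n
      simp [rinner_smul_left, rinner_smul_right, smul_smul, mul_comm]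
    simp only [Set.mem_ofPred_eq, this]
    exact Summable.const_smul _ hx

/-- The Hilbert `B`-module `Y^∞` of square summable sequences in `Y`. For a C⋆-algebra `A`, the
standard module `H_A` is `StdMod A A`. -/
def StdMod : Type _ := stdSubmodule B Y

namespace StdMod

instance : AddCommGroup (StdMod B Y) := inferInstanceAs (AddCommGroup (stdSubmodule B Y))

instance : Module ℂ (StdMod B Y) := inferInstanceAs (Module ℂ (stdSubmodule B Y))

instance : CoeFun (StdMod B Y) fun _ => ℕ → Y := ⟨fun η => η.1⟩

variable {B Y}

@[ext]
lemma ext {x y : StdMod B Y} (h : ∀ n, x n = y n) : x = y := Subtype.ext (funext h)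

@[simp] lemma add_apply (x y : StdMod B Y) (n : ℕ) : (x + y) n = x n + y n := rfl
@[simp] lemma zero_apply (n : ℕ) : (0 : StdMod B Y) n = 0 := rfl
@[simp] lemma smul_apply (c : ℂ) (x : StdMod B Y) (n : ℕ) : (c • x) n = c • x n := rfl
@[simp] lemma sub_apply (x y : StdMod B Y) (n : ℕ) : (x - y) n = x n - y n := rfl

lemma summable (x y : StdMod B Y) : Summable fun n => rinner B (x n) (y n) :=
  summable_rinner x.2 y.2

/-- The right action `{η n} · b = {η n · b}`. -/
instance : SMul Bᵐᵒᵖ (StdMod B Y) where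
  smul b x := ⟨fun n => b • x n, by
    have : (fun n : ℕ => rinner B (b • x n) (b • x n)) =
        fun n => star (unop b) * (rinner B (x n) (x n) * unop b) := by
      funext n
      obtain ⟨b, rfl⟩ := op_surjective b
      rw [rinner_act_left, rinner_act_right, unop_op]
    simp only [stdSubmodule, Submodule.mem_mk, AddSubmonoid.mem_mk, AddSubsemigroup.mem_mk,
      Set.mem_ofPred_eq, this]
    exact (x.2.mul_right _).mul_left _⟩

@[simp] lemma act_apply (b : Bᵐᵒᵖ) (x : StdMod B Y) (n : ℕ) : (b • x) n = b • x n := rfl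

/-- The norm `‖η‖ = ‖∑ ⟪η n, η n⟫‖ ^ (1 / 2)`. -/
instance : Norm (StdMod B Y) := ⟨fun x => √‖∑' n, rinner B (x n) (x n)‖⟩

/-- The Hilbert module structure, with `⟪η, ζ⟫ = ∑ ⟪η n, ζ n⟫`. -/
instance : CStarModule Bᵐᵒᵖ (StdMod B Y) where
  inner x y := op (∑' n, rinner B (x n) (y n))
  inner_add_right {x y z} := by
    simp only [add_apply, rinner_add_right]
    rw [(summable x y).tsum_add (summable x z), op_add]
  inner_self_nonneg {x} := by
    change (0 : B) ≤ ∑' n, rinner B (x n) (x n)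
    exact tsum_nonneg fun n => rinner_self_nonneg _
  inner_self {x} := by
    rw [op_eq_zero_iff]
    constructor
    · intro h
      ext n
      rw [zero_apply, ← rinner_self_eq_zero (B := B)]
      refine le_antisymm ?_ (rinner_self_nonneg _)
      rw [← h]
      exact (summable x x).le_tsum n fun m _ => rinner_self_nonneg _
    · rintro rfl
      simp [rinner]
  inner_op_smul_right {a x y} := by
    obtain ⟨a, rfl⟩ := op_surjective a
    simp only [act_apply, rinner_act_right]
    rw [(summable x y).tsum_mul_right, op_mul]
  inner_smul_right_complex {z x y} := by
    simp only [smul_apply, rinner_smul_right]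
    rw [(summable x y).tsum_const_smul, op_smul]
  star_inner x y := by
    rw [← op_star, tsum_star]
    simp only [star_rinner]
  norm_eq_sqrt_norm_inner_self x := rfl

instance : NormedAddCommGroup (StdMod B Y) := CStarModule.normedAddCommGroup Bᵐᵒᵖ

instance : NormedSpace ℂ (StdMod B Y) := .ofCore (CStarModule.normedSpaceCore Bᵐᵒᵖ)

lemma rinner_def (x y : StdMod B Y) : rinner B x y = ∑' n, rinner B (x n) (y n) := rfl

lemma norm_sum_le (x : StdMod B Y) (s : Finset ℕ) :
    ‖∑ n ∈ s, rinner B (x n) (x n)‖ ≤ ‖x‖ ^ 2 := by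
  rw [norm_sq_rinner (B := B)]
  exact CStarAlgebra.norm_le_norm_of_nonneg_of_le
    (Finset.sum_nonneg fun n _ => rinner_self_nonneg _)
    ((summable x x).sum_le_tsum s fun n _ => rinner_self_nonneg _)

lemma norm_apply_le (x : StdMod B Y) (n : ℕ) : ‖x n‖ ≤ ‖x‖ := by
  have h := norm_sum_le x {n}
  rw [Finset.sum_singleton, ← norm_sq_rinner (B := B)] at h
  exact (sq_le_sq₀ (norm_nonneg _) (norm_nonneg _)).1 h

lemma norm_le_of_sum_le (x : StdMod B Y) {C : ℝ} (hC : 0 ≤ C)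
    (h : ∀ s : Finset ℕ, ‖∑ n ∈ s, rinner B (x n) (x n)‖ ≤ C ^ 2) : ‖x‖ ≤ C := by
  rw [← sq_le_sq₀ (norm_nonneg _) hC, norm_sq_rinner (B := B), rinner_def]
  exact le_of_tendsto ((summable x x).hasSum.norm) (Filter.Eventually.of_forall h)

instance [CompleteSpace Y] : CompleteSpace (StdMod B Y) := by
  refine Metric.complete_of_cauchySeq_tendsto fun u hu => ?_
  have hcoord : ∀ n, CauchySeq fun m => u m n := by
    intro n
    rw [Metric.cauchySeq_iff] at hu ⊢
    intro ε hε
    obtain ⟨N, hN⟩ := hu ε hε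
    refine ⟨N, fun m hm m' hm' => ?_⟩
    have := hN m hm m' hm'
    rw [dist_eq_norm] at this ⊢
    exact (norm_apply_le (u m - u m') n).trans_lt this
  choose y hy using fun n => cauchySeq_tendsto_of_complete (hcoord n)
  have key : ∀ ε > 0, ∃ N, ∀ m ≥ N, ∀ s : Finset ℕ,
      ‖∑ n ∈ s, rinner B (y n - u m n) (y n - u m n)‖ ≤ ε ^ 2 := by
    intro ε hε
    rw [Metric.cauchySeq_iff] at hu
    obtain ⟨N, hN⟩ := hu ε hε
    refine ⟨N, fun m hm s => ?_⟩
    have hlim : Filter.Tendsto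
        (fun m' => ‖∑ n ∈ s, rinner B ((u m' - u m) n) ((u m' - u m) n)‖) Filter.atTop
        (nhds ‖∑ n ∈ s, rinner B (y n - u m n) (y n - u m n)‖) := by
      refine Filter.Tendsto.norm (tendsto_finsetSum s fun n _ => ?_)
      have h1 : Filter.Tendsto (fun m' => u m' n - u m n) Filter.atTop (nhds (y n - u m n)) :=
        (hy n).sub_const _
      exact ((continuous_rinner (B := B)).tendsto (y n - u m n, y n - u m n)).comp
        (h1.prodMk_nhds h1)
    refine le_of_tendsto hlim (Filter.eventually_atTop.2 ⟨N, fun m' hm' => ?_⟩)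
    refine (norm_sum_le _ s).trans ?_
    have := hN m' hm' m hm
    rw [dist_eq_norm] at this
    gcongr
  have hmem : Summable fun n => rinner B (y n) (y n) := by
    rw [summable_iff_vanishing_norm]
    intro ε hε
    obtain ⟨N, hN⟩ := key (√(ε / 4)) (Real.sqrt_pos.2 (by positivity))
    rw [Real.sq_sqrt (by positivity)] at hN
    obtain ⟨s, hs⟩ := summable_iff_vanishing_norm.1 (u N).2 (ε / 4) (by positivity)
    refine ⟨s, fun t ht => ?_⟩
    have h1 : ∑ n ∈ t, rinner B (y n) (y n) ≤ (2 : ℂ) •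
        (∑ n ∈ t, rinner B (y n - u N n) (y n - u N n) + ∑ n ∈ t, rinner B (u N n) (u N n)) := by
      rw [← Finset.sum_add_distrib, Finset.smul_sum]
      refine Finset.sum_le_sum fun n _ => ?_
      simpa using rinner_add_self_le (B := B) (y n - u N n) (u N n)
    have h2 := CStarAlgebra.norm_le_norm_of_nonneg_of_le
      (Finset.sum_nonneg fun n _ => rinner_self_nonneg _) h1
    rw [norm_smul] at h2
    have h3 := norm_add_le (∑ n ∈ t, rinner B (y n - u N n) (y n - u N n))
      (∑ n ∈ t, rinner B (u N n) (u N n))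
    have h4 := hN N le_rfl t
    have h5 := hs t ht
    have h6 : ‖(2 : ℂ)‖ = 2 := by simp
    rw [h6] at h2
    linarith
  let y' : StdMod B Y := ⟨y, hmem⟩
  refine ⟨y', Metric.tendsto_atTop.2 fun ε hε => ?_⟩
  obtain ⟨N, hN⟩ := key (ε / 2) (by positivity)
  refine ⟨N, fun m hm => ?_⟩
  rw [dist_comm, dist_eq_norm]
  exact (norm_le_of_sum_le (y' - u m) (by positivity) (hN m hm)).trans_lt (by linarith)

end StdMod

end Std

/-! ### The interior tensor product -/

section Interior

variable {A B X Y : Type*}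
  [NonUnitalCStarAlgebra A] [PartialOrder A] [StarOrderedRing A]
  [NonUnitalCStarAlgebra B] [PartialOrder B] [StarOrderedRing B]
  [NormedAddCommGroup X] [NormedSpace ℂ X] [SMul Aᵐᵒᵖ X] [CStarModule Aᵐᵒᵖ X]
  [NormedAddCommGroup Y] [NormedSpace ℂ Y] [SMul Bᵐᵒᵖ Y] [CStarModule Bᵐᵒᵖ Y]

lemma exists_factor {C : Type*} [NonUnitalCStarAlgebra C] [PartialOrder C] [StarOrderedRing C]
    {G : C} (hG : IsSelfAdjoint G) :
    ∃ N M S : C, star N * G * N = -(star M * M) ∧ (M = 0 → G = star S * S) := by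
  have hN := CFC.negPart_nonneg G
  have hNs : star G⁻ = G⁻ := hN.isSelfAdjoint
  have h3 : G⁻ * G * G⁻ = -(G⁻ * G⁻ * G⁻) := by
    conv_lhs => enter [1, 2]; rw [← CFC.posPart_sub_negPart G hG]
    rw [mul_sub, CFC.negPart_mul_posPart]
    simp [mul_assoc]
  have hR : CFC.sqrt G⁻ * CFC.sqrt G⁻ = G⁻ := CFC.sqrt_mul_sqrt_self _ hN
  have hRs : star (CFC.sqrt G⁻) = CFC.sqrt G⁻ := (CFC.sqrt_nonneg G⁻).isSelfAdjoint
  refine ⟨G⁻, CFC.sqrt G⁻ * G⁻, CFC.sqrt G, ?_, fun h5 => ?_⟩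
  · have h4 : G⁻ * CFC.sqrt G⁻ * (CFC.sqrt G⁻ * G⁻) = G⁻ * (CFC.sqrt G⁻ * CFC.sqrt G⁻) * G⁻ := by
      simp only [mul_assoc]
    rw [star_mul, hRs, hNs, h3, h4, hR]
  · have h7 : G⁻ * G⁻ = 0 := by
      conv_lhs => enter [1]; rw [← hR]
      rw [mul_assoc, h5, mul_zero]
    have h6 : G⁻ = 0 := by
      rw [← CStarRing.star_mul_self_eq_zero_iff, hNs, h7]
    have h9 := CFC.posPart_sub_negPart G hG
    rw [h6, sub_zero] at h9
    have h8 : 0 ≤ G := by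
      rw [← h9]
      exact CFC.posPart_nonneg G
    rw [(CFC.sqrt_nonneg G).isSelfAdjoint.star_eq, CFC.sqrt_mul_sqrt_self G h8]

/-- The Gram matrix of a finite family factors as `S⋆ S`. -/
lemma exists_gram_factor {ι : Type*} [Fintype ι] (x : ι → X) :
    ∃ S : ι → ι → A, ∀ i j, rinner A (x i) (x j) = ∑ k, star (S k i) * S k j := by
  let G : CStarMatrix ι ι A := CStarMatrix.ofMatrix fun i j => rinner A (x i) (x j)
  have hG : IsSelfAdjoint G := by
    ext i j
    exact star_rinner _ _
  obtain ⟨N, M, S, h1, h2⟩ := exists_factor hG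
  have hM : M = 0 := by
    ext i k
    have e1 : (star N * G * N) k k = rinner A (∑ i, op (N i k) • x i) (∑ i, op (N i k) • x i) := by
      simp only [rinner, CStarModule.inner_sum_left, CStarModule.inner_sum_right,
        CStarMatrix.mul_apply, CStarModule.inner_op_smul_left, CStarModule.inner_op_smul_right,
        Finset.unop_sum, Finset.sum_mul, unop_mul, unop_star, unop_op]
      refine Finset.sum_congr rfl fun i _ => Finset.sum_congr rfl fun j _ => ?_
      rfl
    have e2 : (star M * M) k k = ∑ i, star (M i k) * M i k := by
      rw [CStarMatrix.mul_apply]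
      rfl
    have e3 : ∑ i, star (M i k) * M i k ≤ 0 := by
      have : (star N * G * N) k k = -((star M * M) k k) := by rw [h1]; rfl
      rw [← e2, ← neg_nonneg, ← this, e1]
      exact rinner_self_nonneg _
    have e4 : star (M i k) * M i k ≤ 0 :=
      (Finset.single_le_sum (f := fun i => star (M i k) * M i k)
        (fun j _ => star_mul_self_nonneg _) (Finset.mem_univ i)).trans e3
    exact (CStarRing.star_mul_self_eq_zero_iff _).1 (le_antisymm e4 (star_mul_self_nonneg _))
  refine ⟨fun i j => S i j, fun i j => ?_⟩
  have h11 : (star S * S) i j = G i j := by rw [← h2 hM]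
  rw [CStarMatrix.mul_apply] at h11
  exact h11.symm

variable (X) (ρ : A →⋆ₙₐ[ℂ] Adj B Y)

/-- The algebraic tensor product `X ⊗ Y`, to be equipped with the semi-inner product
`⟪x ⊗ y, x' ⊗ y'⟫ = ⟪y, ρ ⟪x, x'⟫ y'⟫`. -/
def PreTensor (_ρ : A →⋆ₙₐ[ℂ] Adj B Y) : Type _ := X ⊗[ℂ] Y

namespace PreTensor

instance : AddCommGroup (PreTensor X ρ) := inferInstanceAs (AddCommGroup (X ⊗[ℂ] Y))

instance : Module ℂ (PreTensor X ρ) := inferInstanceAs (Module ℂ (X ⊗[ℂ] Y))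

variable {X}

/-- The elementary tensor `x ⊗ y`. -/
def tmul (x : X) (y : Y) : PreTensor X ρ := x ⊗ₜ[ℂ] y

variable (X)

/-- The semi-inner product as a sesquilinear form. -/
def form : PreTensor X ρ →ₗ⋆[ℂ] PreTensor X ρ →ₗ[ℂ] B :=
  TensorProduct.lift (R := ℂ) (M := X) (N := Y) (σ₁₂ := starRingEnd ℂ)
    (LinearMap.mk₂'ₛₗ (starRingEnd ℂ) (starRingEnd ℂ)
    (fun x y => TensorProduct.lift (R := ℂ) (M := X) (N := Y) (σ₁₂ := RingHom.id ℂ) (LinearMap.mk₂ ℂ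
      (fun x' y' => rinner B y ((ρ (rinner A x x')).app y'))
      (fun x₁ x₂ y' => by simp [Adj.app, rinner_add_right])
      (fun c x' y' => by simp [Adj.app, rinner_smul_right])
      (fun x' y₁ y₂ => by simp [Adj.app, rinner_add_right])
      (fun c x' y' => by simp [Adj.app, rinner_smul_right])))
    (fun x₁ x₂ y => by refine TensorProduct.ext' fun x' y' => ?_; simp [Adj.app, rinner_add_right, rinner_add_left]; rfl)
    (fun c x y => by refine TensorProduct.ext' fun x' y' => ?_; simp [Adj.app, rinner_smul_right, rinner_smul_left]; rfl)
    (fun x y₁ y₂ => by refine TensorProduct.ext' fun x' y' => ?_; simp [Adj.app, rinner_add_left]; rfl)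
    (fun c x y => by refine TensorProduct.ext' fun x' y' => ?_; simp [Adj.app, rinner_smul_left]; rfl))

lemma form_tmul (x x' : X) (y y' : Y) :
    form X ρ (tmul ρ x y) (tmul ρ x' y') = rinner B y ((ρ (rinner A x x')).app y') := rfl

variable {X ρ}

@[elab_as_elim]
lemma induction_on {p : PreTensor X ρ → Prop} (t : PreTensor X ρ) (zero : p 0)
    (tmul : ∀ x y, p (tmul ρ x y)) (add : ∀ s t, p s → p t → p (s + t)) : p t :=
  TensorProduct.induction_on (R := ℂ) (M := X) (N := Y) (motive := p) t zero tmul add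

lemma exists_sum (t : PreTensor X ρ) :
    ∃ (n : ℕ) (x : Fin n → X) (y : Fin n → Y), t = ∑ i, tmul ρ (x i) (y i) :=
  TensorProduct.exists_sum_tmul_eq (R := ℂ) (M := X) (N := Y) t

lemma star_form (s t : PreTensor X ρ) : star (form X ρ s t) = form X ρ t s := by
  induction s using induction_on with
  | zero => simp
  | add s s' hs hs' => simp [hs, hs']
  | tmul x y =>
    induction t using induction_on with
    | zero => simp
    | add t t' ht ht' => simp [ht, ht']
    | tmul x' y' =>
      rw [form_tmul, form_tmul, star_rinner, Adj.adjoint, ← map_star, star_rinner]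

lemma form_nonneg (t : PreTensor X ρ) : 0 ≤ form X ρ t t := by
  obtain ⟨n, x, y, rfl⟩ := exists_sum t
  obtain ⟨S, hS⟩ := exists_gram_factor (A := A) x
  have : form X ρ (∑ i, tmul ρ (x i) (y i)) (∑ i, tmul ρ (x i) (y i)) =
      ∑ k, rinner B (∑ i, (ρ (S k i)).app (y i)) (∑ i, (ρ (S k i)).app (y i)) := by
    have hterm : ∀ i j, rinner B (y i) ((ρ (rinner A (x i) (x j))).app (y j)) =
        ∑ k, rinner B ((ρ (S k i)).app (y i)) ((ρ (S k j)).app (y j)) := by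
      intro i j
      rw [hS, map_sum]
      simp only [Adj.app, AddSubmonoidClass.coe_finsetSum, sum_apply,
        rinner_sum_right]
      refine Finset.sum_congr rfl fun k _ => ?_
      rw [map_mul, map_star]
      exact (Adj.adjoint (ρ (S k i)) (y i) _).symm
    simp only [map_sum, LinearMap.sum_apply, form_tmul, hterm, rinner_sum_left, rinner_sum_right]
    rw [Finset.sum_comm_cycle]
  rw [this]
  exact Finset.sum_nonneg fun k _ => rinner_self_nonneg _

variable (X ρ) in
/-- The right action of `b` on elementary tensors is `x ⊗ y ↦ x ⊗ (y · b)`. -/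
def act (b : B) : PreTensor X ρ →ₗ[ℂ] PreTensor X ρ :=
  LinearMap.lTensor X
    { toFun := fun y : Y => op b • y
      map_add' := act_add b
      map_smul' := act_smul b }

instance : SMul Bᵐᵒᵖ (PreTensor X ρ) := ⟨fun b t => act X ρ (unop b) t⟩

lemma act_tmul (b : B) (x : X) (y : Y) : op b • tmul ρ x y = tmul ρ x (op b • y) := rfl

lemma form_act_right (b : B) (s t : PreTensor X ρ) :
    form X ρ s (op b • t) = form X ρ s t * b := by
  change form X ρ s (act X ρ b t) = _
  induction s using induction_on with
  | zero => simp
  | add s s' hs hs' => simp [hs, hs', add_mul]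
  | tmul x y =>
    induction t using induction_on with
    | zero => simp
    | add t t' ht ht' => simp [ht, ht', add_mul]
    | tmul x' y' =>
      change form X ρ (tmul ρ x y) (tmul ρ x' (op b • y')) = _
      rw [form_tmul, form_tmul, Adj.adjoint', rinner_act_right, ← Adj.adjoint']

lemma form_act_left (b : B) (s t : PreTensor X ρ) :
    form X ρ (op b • s) t = star b * form X ρ s t := by
  rw [← star_form, form_act_right, star_mul, star_form]

lemma norm_form_sq_le (s t : PreTensor X ρ) :
    ‖form X ρ s t‖ ^ 2 ≤ ‖form X ρ s s‖ * ‖form X ρ t t‖ := by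
  set p := form X ρ s s with hp
  set q := form X ρ t t with hq
  set r := form X ρ s t with hr
  have hr' : form X ρ t s = star r := (star_form s t).symm
  have key : ∀ c : ℝ, ‖p‖ < c → ‖r‖ ^ 2 ≤ c * ‖q‖ := by
    intro c hc
    have hc0 : 0 < c := (norm_nonneg _).trans_lt hc
    have h1 := form_nonneg (t - op (c⁻¹ • r) • s)
    have h2 : form X ρ (t - op (c⁻¹ • r) • s) (t - op (c⁻¹ • r) • s) =
        q - c⁻¹ • (star r * r) - (c⁻¹ • (star r * r) - c⁻¹ • (c⁻¹ • (star r * p * r))) := by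
      simp only [map_sub, LinearMap.sub_apply, form_act_left, form_act_right, hr', ← hp, ← hq,
        ← hr, star_smul, star_trivial, mul_smul_comm, smul_mul_assoc, mul_assoc]
    have h3 : star r * p * r ≤ c • (star r * r) := by
      refine (CStarAlgebra.star_left_conjugate_le_norm_smul
        (form_nonneg s).isSelfAdjoint).trans ?_
      exact smul_le_smul_of_nonneg_right hc.le (star_mul_self_nonneg r)
    have h4 : c⁻¹ • (c⁻¹ • (star r * p * r)) ≤ c⁻¹ • (star r * r) := by
      refine smul_le_smul_of_nonneg_left ?_ (inv_nonneg.2 hc0.le)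
      rw [inv_smul_le_iff_of_pos hc0]
      exact h3
    have h5 : c⁻¹ • (star r * r) ≤ q := by
      rw [h2] at h1
      have := add_nonneg h1 (sub_nonneg.2 h4)
      rw [← sub_nonneg]
      convert this using 1
      abel
    have h6 := CStarAlgebra.norm_le_norm_of_nonneg_of_le
      (smul_nonneg (inv_nonneg.2 hc0.le) (star_mul_self_nonneg r)) h5
    rw [norm_smul, CStarRing.norm_star_mul_self, Real.norm_of_nonneg (inv_nonneg.2 hc0.le),
      inv_mul_le_iff₀ hc0] at h6
    rwa [sq]
  refine le_of_forall_pos_le_add fun ε hε => ?_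
  have h := key (‖p‖ + ε / (‖q‖ + 1)) (by
    have : 0 < ε / (‖q‖ + 1) := by positivity
    linarith)
  refine h.trans ?_
  rw [add_mul]
  gcongr
  rw [div_mul_eq_mul_div, div_le_iff₀ (by positivity)]
  nlinarith [norm_nonneg q]

instance : Norm (PreTensor X ρ) := ⟨fun t => √‖form X ρ t t‖⟩

lemma norm_def (t : PreTensor X ρ) : ‖t‖ = √‖form X ρ t t‖ := rfl

lemma norm_sq (t : PreTensor X ρ) : ‖t‖ ^ 2 = ‖form X ρ t t‖ := Real.sq_sqrt (norm_nonneg _)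

lemma norm_form_le (s t : PreTensor X ρ) : ‖form X ρ s t‖ ≤ ‖s‖ * ‖t‖ := by
  rw [norm_def, norm_def, ← Real.sqrt_mul (norm_nonneg _)]
  exact Real.le_sqrt_of_sq_le (norm_form_sq_le s t)

lemma core : SeminormedSpace.Core ℂ (PreTensor X ρ) where
  norm_nonneg t := Real.sqrt_nonneg _
  norm_smul c t := by
    simp only [norm_def, map_smulₛₗ, LinearMap.smul_apply, norm_smul]
    rw [← mul_assoc, Real.sqrt_mul (by positivity)]
    simp
  norm_triangle s t := by
    have hs : 0 ≤ ‖s‖ := Real.sqrt_nonneg _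
    have ht : 0 ≤ ‖t‖ := Real.sqrt_nonneg _
    rw [norm_def]
    refine Real.sqrt_le_iff.2 ⟨by positivity, ?_⟩
    have h1 := norm_form_le s t
    have h2 := norm_form_le t s
    have h3 := norm_add₄_le (a := form X ρ s s) (b := form X ρ t s) (c := form X ρ s t)
      (d := form X ρ t t)
    have h4 : form X ρ (s + t) (s + t) =
      form X ρ s s + form X ρ t s + form X ρ s t + form X ρ t t := by
        simp only [map_add, LinearMap.add_apply]; abel
    rw [h4]
    rw [← norm_sq, ← norm_sq] at h3
    nlinarith

instance : SeminormedAddCommGroup (PreTensor X ρ) := .ofCore core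

instance : NormedSpace ℂ (PreTensor X ρ) := ⟨fun c t => (core.norm_smul c t).le⟩

instance : Inner Bᵐᵒᵖ (PreTensor X ρ) := ⟨fun s t => op (form X ρ s t)⟩

lemma norm_act_le (b : B) (t : PreTensor X ρ) : ‖op b • t‖ ≤ ‖b‖ * ‖t‖ := by
  have ht : 0 ≤ ‖t‖ := norm_nonneg _
  rw [norm_def]
  refine Real.sqrt_le_iff.2 ⟨by positivity, ?_⟩
  rw [form_act_right, form_act_left, mul_pow, norm_sq]
  calc ‖star b * form X ρ t t * b‖ ≤ ‖star b‖ * ‖form X ρ t t‖ * ‖b‖ := by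
        refine (norm_mul_le _ _).trans ?_
        gcongr
        exact norm_mul_le _ _
    _ = _ := by rw [norm_star]; ring

/-- The right action of `b`, as a bounded operator. -/
def actL (b : B) : PreTensor X ρ →L[ℂ] PreTensor X ρ :=
  (act X ρ b).mkContinuous ‖b‖ (norm_act_le b)

instance : UniformContinuousConstSMul Bᵐᵒᵖ (PreTensor X ρ) :=
  ⟨fun b => (actL (X := X) (ρ := ρ) (unop b)).uniformContinuous⟩

lemma continuous_inner : Continuous fun p : PreTensor X ρ × PreTensor X ρ => inner Bᵐᵒᵖ p.1 p.2 := by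
  have h : Continuous fun p : PreTensor X ρ × PreTensor X ρ =>
      LinearMap.mkContinuous₂ (form X ρ) 1 (fun s t => by rw [one_mul]; exact norm_form_le s t) p.1 p.2 := by
    fun_prop
  exact continuous_op.comp h

end PreTensor

/-- The interior tensor product `X ⊗̂_A Y` over `ρ : A → ℒ(Y)`: the Hausdorff completion of the
algebraic tensor product with respect to the semi-inner product
`⟪x ⊗ y, x' ⊗ y'⟫ = ⟪y, ρ ⟪x, x'⟫ y'⟫`. (The relations `x · a ⊗ y = x ⊗ ρ a y` hold after dividing
by the vectors of length zero, so one may start from the tensor product over `ℂ`.) -/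
abbrev IntTensor : Type _ := UniformSpace.Completion (PreTensor X ρ)

namespace IntTensor

open UniformSpace

variable {X}

/-- The elementary tensor `x ⊗ y` in `X ⊗̂_A Y`. -/
def tmul (x : X) (y : Y) : IntTensor X ρ := (PreTensor.tmul ρ x y : Completion (PreTensor X ρ))

variable {ρ}

lemma inner_coe (s t : PreTensor X ρ) :
    inner Bᵐᵒᵖ (s : Completion (PreTensor X ρ)) (t : Completion (PreTensor X ρ)) = inner Bᵐᵒᵖ s t :=
  (Completion.isDenseInducing_coe.prodMap Completion.isDenseInducing_coe).extend_eq
    (PreTensor.continuous_inner (X := X) (ρ := ρ)) (s, t)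

lemma continuous_inner_uncurry :
    Continuous (Function.uncurry (inner Bᵐᵒᵖ (E := IntTensor X ρ))) := by
  let inner' : PreTensor X ρ →+ PreTensor X ρ →+ Bᵐᵒᵖ :=
    { toFun := fun s => (opAddEquiv : B ≃+ Bᵐᵒᵖ).toAddMonoidHom.comp
        (PreTensor.form X ρ s).toAddMonoidHom
      map_zero' := by ext x; simp
      map_add' := fun x y => by ext z; simp }
  have : Continuous fun p : PreTensor X ρ × PreTensor X ρ => inner' p.1 p.2 :=
    PreTensor.continuous_inner
  rw [Completion.toInner, inner, Function.uncurry_curry]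
  change
    Continuous
      (((Completion.isDenseInducing_toCompl (PreTensor X ρ)).prodMap
        (Completion.isDenseInducing_toCompl (PreTensor X ρ))).extend
        fun p : PreTensor X ρ × PreTensor X ρ => inner' p.1 p.2)
  exact (Completion.isDenseInducing_toCompl _).extend_Z_bilin
    (Completion.isDenseInducing_toCompl _) this

@[fun_prop]
lemma continuous_inner {α : Type*} [TopologicalSpace α] {f g : α → IntTensor X ρ}
    (hf : Continuous f) (hg : Continuous g) : Continuous fun a => inner Bᵐᵒᵖ (f a) (g a) :=
  continuous_inner_uncurry.comp (hf.prodMk hg)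

lemma norm_eq_sqrt (x : IntTensor X ρ) : ‖x‖ = √‖inner Bᵐᵒᵖ x x‖ := by
  induction x using Completion.induction_on with
  | hp => exact isClosed_eq (by fun_prop) (by fun_prop)
  | ih s =>
    rw [inner_coe, Completion.norm_coe]
    rfl

/-- The Hilbert `B`-module structure of the interior tensor product, extended by continuity. -/
instance : CStarModule Bᵐᵒᵖ (IntTensor X ρ) where
  toInner := Completion.toInner
  inner_add_right {x y z} := by
    induction x, y, z using Completion.induction_on₃ with
    | hp => exact isClosed_eq (by fun_prop) (by fun_prop)
    | ih s t u =>
      rw [← Completion.coe_add, inner_coe, inner_coe, inner_coe]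
      simp [inner]
  inner_self_nonneg {x} := by
    induction x using Completion.induction_on with
    | hp => exact isClosed_le continuous_const (by fun_prop)
    | ih s =>
      rw [inner_coe]
      exact PreTensor.form_nonneg s
  inner_self {x} := by
    rw [← norm_eq_zero (a := x), norm_eq_sqrt, Real.sqrt_eq_zero (norm_nonneg _), norm_eq_zero]
  inner_op_smul_right {a x y} := by
    induction x, y using Completion.induction_on₂ with
    | hp =>
      refine isClosed_eq ?_ (by fun_prop)
      exact continuous_inner continuous_fst ((continuous_const_smul a).comp continuous_snd)
    | ih s t =>
      obtain ⟨a, rfl⟩ := op_surjective a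
      rw [← Completion.coe_smul, inner_coe, inner_coe]
      exact congrArg op (PreTensor.form_act_right a s t)
  inner_smul_right_complex {z x y} := by
    induction x, y using Completion.induction_on₂ with
    | hp =>
      refine isClosed_eq ?_ (by fun_prop)
      exact continuous_inner continuous_fst ((continuous_const_smul z).comp continuous_snd)
    | ih s t =>
      rw [← Completion.coe_smul, inner_coe, inner_coe]
      simp [inner]
  star_inner x y := by
    induction x, y using Completion.induction_on₂ with
    | hp => exact isClosed_eq (by fun_prop) (by fun_prop)
    | ih s t =>
      rw [inner_coe, inner_coe]
      exact congrArg op (PreTensor.star_form s t)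
  norm_eq_sqrt_norm_inner_self x := norm_eq_sqrt x

end IntTensor

end Interior

/-! ### Bounded operators on interior tensor products -/

section Operators

variable {A B X Y : Type*}
  [NonUnitalCStarAlgebra A] [PartialOrder A] [StarOrderedRing A]
  [NonUnitalCStarAlgebra B] [PartialOrder B] [StarOrderedRing B]
  [NormedAddCommGroup X] [NormedSpace ℂ X] [SMul Aᵐᵒᵖ X] [CStarModule Aᵐᵒᵖ X]
  [NormedAddCommGroup Y] [NormedSpace ℂ Y] [CompleteSpace Y] [SMul Bᵐᵒᵖ Y] [CStarModule Bᵐᵒᵖ Y]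

variable (A X) in
/-- A bounded adjointable isometry `W : X → H_A` (so that `W⋆ W = 1`). -/
structure AdjIsometry where
  /-- The operator `W`. -/
  toCLM : X →L[ℂ] StdMod A A
  /-- The adjoint `W⋆`. -/
  adj : StdMod A A →L[ℂ] X
  isAdjoint : IsAdjointPair A toCLM adj
  adj_apply_apply : ∀ ξ, adj (toCLM ξ) = ξ

lemma AdjIsometry.rinner_map (W : AdjIsometry A X) (ξ η : X) :
    rinner A (W.toCLM ξ) (W.toCLM η) = rinner A ξ η := by
  rw [W.isAdjoint, W.adj_apply_apply]

variable (ρ : A →⋆ₙₐ[ℂ] Adj B Y)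

/-- The bounded linear map `a ↦ ⟪y, ρ a y'⟫`. -/
def coeffL (y y' : Y) : A →L[ℂ] B :=
  LinearMap.mkContinuous
    { toFun := fun a => rinner B y ((ρ a).app y')
      map_add' := fun a b => by simp [Adj.app, rinner_add_right]
      map_smul' := fun c a => by simp [Adj.app, rinner_smul_right] } (‖y‖ * ‖y'‖) fun a => by
    refine (norm_rinner_le _ _).trans ?_
    rw [mul_assoc]
    gcongr
    rw [mul_comm]
    refine (ContinuousLinearMap.le_opNorm _ _).trans ?_
    gcongr
    exact NonUnitalStarAlgHom.norm_apply_le ρ a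

lemma coeffL_apply (y y' : Y) (a : A) : coeffL ρ y y' a = rinner B y ((ρ a).app y') := rfl

lemma rinner_rep (a b : A) (y y' : Y) :
    rinner B ((ρ a).app y) ((ρ b).app y') = coeffL ρ y y' (star a * b) := by
  rw [Adj.adjoint, coeffL_apply, map_mul, map_star]
  rfl

/-- The sequence `{ρ (a k) y}` in `Y^∞`, for `a` in `H_A` and `y` in `Y`. -/
def StdMod.applyVec (a : StdMod A A) (y : Y) : StdMod B Y :=
  ⟨fun k => (ρ (a k)).app y, by
    have h : (fun k => rinner B ((ρ (a k)).app y) ((ρ (a k)).app y)) =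
        fun k => coeffL ρ y y (rinner A (a k) (a k)) := by
      funext k
      rw [rinner_rep, rinner_self_def]
    change Summable _
    rw [h]
    exact (StdMod.summable a a).mapL (coeffL ρ y y)⟩

lemma StdMod.applyVec_apply (a : StdMod A A) (y : Y) (k : ℕ) :
    StdMod.applyVec ρ a y k = (ρ (a k)).app y := rfl

lemma StdMod.rinner_applyVec (a b : StdMod A A) (y y' : Y) :
    rinner B (StdMod.applyVec ρ a y) (StdMod.applyVec ρ b y') =
      rinner B y ((ρ (rinner A a b)).app y') := by
  rw [StdMod.rinner_def, StdMod.rinner_def, ← coeffL_apply, (coeffL ρ y y').map_tsum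
    (StdMod.summable a b)]
  refine tsum_congr fun k => ?_
  rw [StdMod.applyVec_apply, StdMod.applyVec_apply, rinner_rep, rinner_self_def]

namespace AdjIsometry

variable (W : AdjIsometry A X)

/-- `x ⊗ y ↦ {ρ ((W x) k) y}` on the algebraic tensor product. -/
def preTensorOne : PreTensor X ρ →ₗ[ℂ] StdMod B Y :=
  TensorProduct.lift (R := ℂ) (M := X) (N := Y) (σ₁₂ := RingHom.id ℂ) (LinearMap.mk₂ ℂ
    (fun x y => StdMod.applyVec ρ (W.toCLM x) y)
    (fun x x' y => by ext k; simp [StdMod.applyVec_apply, Adj.app])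
    (fun c x y => by ext k; simp [StdMod.applyVec_apply, Adj.app])
    (fun x y y' => by ext k; simp [StdMod.applyVec_apply, Adj.app])
    (fun c x y => by ext k; simp [StdMod.applyVec_apply, Adj.app]))

lemma preTensorOne_tmul (x : X) (y : Y) :
    W.preTensorOne ρ (PreTensor.tmul ρ x y) = StdMod.applyVec ρ (W.toCLM x) y := rfl

lemma rinner_preTensorOne (s t : PreTensor X ρ) :
    rinner B (W.preTensorOne ρ s) (W.preTensorOne ρ t) = PreTensor.form X ρ s t := by
  induction s using PreTensor.induction_on with
  | zero => simp [rinner]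
  | add s s' hs hs' => simp [rinner_add_left, hs, hs']
  | tmul x y =>
    induction t using PreTensor.induction_on with
    | zero => simp [rinner]
    | add t t' ht ht' => simp [rinner_add_right, ht, ht']
    | tmul x' y' =>
      rw [preTensorOne_tmul, preTensorOne_tmul, StdMod.rinner_applyVec, rinner_map,
        PreTensor.form_tmul]

/-- The bounded operator `W ⊗ 1 : X ⊗̂_A Y → Y^∞`, `x ⊗ y ↦ {ρ ((W x) k) y}`. -/
def tensorOne : IntTensor X ρ →L[ℂ] StdMod B Y :=
  ((W.preTensorOne ρ).mkContinuous 1 fun t => by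
    rw [one_mul, ← sq_le_sq₀ (norm_nonneg _) (norm_nonneg _), norm_sq_rinner (B := B),
      rinner_preTensorOne, PreTensor.norm_sq]).extend UniformSpace.Completion.toComplL

lemma tensorOne_tmul (x : X) (y : Y) (k : ℕ) :
    W.tensorOne ρ (IntTensor.tmul ρ x y) k = (ρ (W.toCLM x k)).app y := by
  have h := ContinuousLinearMap.extend_eq ((W.preTensorOne ρ).mkContinuous 1 fun t => by
    rw [one_mul, ← sq_le_sq₀ (norm_nonneg _) (norm_nonneg _), norm_sq_rinner (B := B),
      rinner_preTensorOne, PreTensor.norm_sq]) (e := UniformSpace.Completion.toComplL)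
    UniformSpace.Completion.denseRange_coe
    (UniformSpace.Completion.isUniformInducing_coe _) (PreTensor.tmul ρ x y)
  exact congrArg (fun z : StdMod B Y => z k) h

end AdjIsometry

end Operators

/-! ### Unbounded operators -/

section Unbounded

variable (B : Type*) {Y : Type*} [NonUnitalCStarAlgebra B] [PartialOrder B] [StarOrderedRing B]
  [NormedAddCommGroup Y] [NormedSpace ℂ Y] [SMul Bᵐᵒᵖ Y] [CStarModule Bᵐᵒᵖ Y]

/-- The graph of the adjoint `D⋆` of a densely defined operator `D`: the pairs `(y, z)` with
`⟪D x, y⟫ = ⟪x, z⟫` for all `x` in the domain of `D`. -/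
def adjointGraph (D : Y →ₗ.[ℂ] Y) : Set (Y × Y) :=
  {p | ∀ x : D.domain, rinner B (D x) p.1 = rinner B (x : Y) p.2}

/-- `D` is densely defined and `D = D⋆`. -/
def IsSelfAdjointOp (D : Y →ₗ.[ℂ] Y) : Prop :=
  Dense (D.domain : Set Y) ∧ (D.graph : Set (Y × Y)) = adjointGraph B D

/-- `D` is regular: it is closed and densely defined, its adjoint is densely defined, and
`1 + D⋆ D` has dense range. -/
def IsRegularOp (D : Y →ₗ.[ℂ] Y) : Prop :=
  D.IsClosed ∧ Dense (D.domain : Set Y) ∧ Dense (Prod.fst '' adjointGraph B D) ∧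
    Dense {w : Y | ∃ (x : D.domain) (z : Y), (D x, z) ∈ adjointGraph B D ∧ w = x + z}

/-- `T` is symmetric: densely defined with `⟪T σ, τ⟫ = ⟪σ, T τ⟫` on its domain. -/
def IsSymmetricOp (T : Y →ₗ.[ℂ] Y) : Prop :=
  Dense (T.domain : Set Y) ∧
    ∀ σ τ : T.domain, rinner B (T σ) (τ : Y) = rinner B (σ : Y) (T τ)

/-- The domain of `T` is a right `B`-submodule, on which `T` is `B`-linear. -/
def IsRightLinearOp (T : Y →ₗ.[ℂ] Y) : Prop :=
  ∀ (σ : T.domain) (b : B), ∃ h : op b • (σ : Y) ∈ T.domain,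
    T ⟨op b • (σ : Y), h⟩ = op b • T σ

end Unbounded

/-- The composition `f ∘ T` of a partially defined map with a linear map, on `T⁻¹ (dom f)`. -/
def precomp {E F G : Type*} [AddCommGroup E] [Module ℂ E] [AddCommGroup F] [Module ℂ F]
    [AddCommGroup G] [Module ℂ G] (f : F →ₗ.[ℂ] G) (T : E →ₗ[ℂ] F) : E →ₗ.[ℂ] G where
  domain := f.domain.comap T
  toFun := f.toFun ∘ₗ T.restrict (p := f.domain.comap T) (q := f.domain) fun _ h => h

section Diag

variable (A B : Type*) {X Y : Type*}
  [NonUnitalCStarAlgebra A] [PartialOrder A] [StarOrderedRing A]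
  [NonUnitalCStarAlgebra B] [PartialOrder B] [StarOrderedRing B]
  [NormedAddCommGroup X] [NormedSpace ℂ X] [SMul Aᵐᵒᵖ X] [CStarModule Aᵐᵒᵖ X]
  [NormedAddCommGroup Y] [NormedSpace ℂ Y] [SMul Bᵐᵒᵖ Y] [CStarModule Bᵐᵒᵖ Y]

/-- `diag f : {η k} ↦ {f (η k)}`, defined on those `η` in `X^∞` for which every `η k` lies in the
domain of `f` and `{f (η k)}` lies in `Y^∞`. -/
def diag (f : X →ₗ.[ℂ] Y) : StdMod A X →ₗ.[ℂ] StdMod B Y where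
  domain :=
    { carrier := {η | ∃ h : ∀ k, η k ∈ f.domain, (fun k => f ⟨η k, h k⟩) ∈ stdSubmodule B Y}
      zero_mem' := ⟨fun k => f.domain.zero_mem, by
        have : (fun k : ℕ => f ⟨(0 : StdMod A X) k, f.domain.zero_mem⟩) = 0 := by
          funext k; exact f.map_zero
        rw [this]; exact zero_mem _⟩
      add_mem' := by
        rintro η θ ⟨h, hs⟩ ⟨h', hs'⟩
        refine ⟨fun k => f.domain.add_mem (h k) (h' k), ?_⟩
        have : (fun k => f ⟨(η + θ) k, f.domain.add_mem (h k) (h' k)⟩) =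
            (fun k => f ⟨η k, h k⟩) + fun k => f ⟨θ k, h' k⟩ := by
          funext k; exact f.map_add ⟨η k, h k⟩ ⟨θ k, h' k⟩
        rw [this]; exact add_mem hs hs'
      smul_mem' := by
        rintro c η ⟨h, hs⟩
        refine ⟨fun k => f.domain.smul_mem c (h k), ?_⟩
        have : (fun k => f ⟨(c • η) k, f.domain.smul_mem c (h k)⟩) =
            c • fun k => f ⟨η k, h k⟩ := by
          funext k; exact f.map_smul c ⟨η k, h k⟩
        rw [this]; exact Submodule.smul_mem _ c hs }
  toFun :=
    { toFun := fun η => ⟨fun k => f ⟨η.1 k, η.2.choose k⟩, η.2.choose_spec⟩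
      map_add' := fun η θ => StdMod.ext fun k =>
        f.map_add ⟨η.1 k, η.2.choose k⟩ ⟨θ.1 k, θ.2.choose k⟩
      map_smul' := fun c η => StdMod.ext fun k => f.map_smul c ⟨η.1 k, η.2.choose k⟩ }

end Diag

/-! ### The derivation, differentiable compact operators and forms -/

section Derivation

variable {A B X Y : Type*}
  [NonUnitalCStarAlgebra A] [PartialOrder A] [StarOrderedRing A]
  [NonUnitalCStarAlgebra B] [PartialOrder B] [StarOrderedRing B]
  [NormedAddCommGroup X] [NormedSpace ℂ X] [CompleteSpace X] [SMul Aᵐᵒᵖ X] [CStarModule Aᵐᵒᵖ X]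
  [NormedAddCommGroup Y] [NormedSpace ℂ Y] [CompleteSpace Y] [SMul Bᵐᵒᵖ Y] [CStarModule Bᵐᵒᵖ Y]

section

variable {𝒜 : NonUnitalStarSubalgebra ℂ A} (δ : 𝒜 →ₗ[ℂ] Adj B Y)

/-- The closure of the derivation `δ`. Its domain is `A_δ`, the completion of `𝒜` in the norm
`‖a‖ + ‖δ a‖` realised inside `A`, and its values are those of the extension of `δ` to `A_δ`. -/
def derivClosure : A →ₗ.[ℂ] Adj B Y :=
  (LinearPMap.mk 𝒜.toNonUnitalSubalgebra.toSubmodule δ).closure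

/-- The standard module `H_{A_δ}`: the sequences `{a n}` in `H_A` with all `a n` in `A_δ` and
`{δ (a n)}` in the standard module over `ℒ(Y)`. -/
def diffStdMod : Submodule ℂ (StdMod A A) :=
  (diag A (Adj B Y) (derivClosure δ)).domain

/-- `T` is the operator on the standard module `H_C` given by the finite matrix `m` over `C`. -/
def IsMatrixOp {C : Type*} [NonUnitalCStarAlgebra C] [PartialOrder C] [StarOrderedRing C] {n : ℕ}
    (m : Matrix (Fin n) (Fin n) C) (T : StdMod C C →L[ℂ] StdMod C C) : Prop :=
  ∀ (x : StdMod C C) (i : ℕ),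
    T x i = if h : i < n then ∑ j : Fin n, m ⟨i, h⟩ j * x j else 0

variable (A X) in
/-- The compact operators on a Hilbert module: the norm closure of the span of the operators
`z ↦ x · ⟪y, z⟫`. -/
def compactOps : Set (X →L[ℂ] X) :=
  closure (Submodule.span ℂ {T : X →L[ℂ] X | ∃ x y : X, ∀ z, T z = op (rinner A y z) • x} :
    Set (X →L[ℂ] X))

/-- The differentiable compact operators `𝒦(H_A)_δ`: the completion of the finite matrices `m` over
`𝒜` in the norm `‖m‖ + ‖δ m‖`, with `δ` applied entrywise, realised as a set of operators on
`H_A`. -/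
def diffCompactOps : Set (StdMod A A →L[ℂ] StdMod A A) :=
  Prod.fst '' closure
    {p : (StdMod A A →L[ℂ] StdMod A A) ×
        (StdMod (Adj B Y) (Adj B Y) →L[ℂ] StdMod (Adj B Y) (Adj B Y)) |
      ∃ (n : ℕ) (m : Matrix (Fin n) (Fin n) 𝒜),
        IsMatrixOp (m.map fun a => (a : A)) p.1 ∧ IsMatrixOp (m.map δ) p.2}

/-- The properties of a differentiable absorption `W : X → H_A`, `K : H_A → H_A`, with `P = W W⋆`:
`K` is positive, `K P = P K`, `W⋆ K W` has dense image, `P K` is compact and `P K²` is a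
differentiable compact operator. -/
structure IsDiffAbsorption (W : AdjIsometry A X) (K : Adj A (StdMod A A)) : Prop where
  nonneg : 0 ≤ K
  comm : K.1 ∘L (W.toCLM ∘L W.adj) = (W.toCLM ∘L W.adj) ∘L K.1
  dense : DenseRange (W.adj ∘L K.1 ∘L W.toCLM)
  compact : (W.toCLM ∘L W.adj) ∘L K.1 ∈ compactOps A (StdMod A A)
  diff : (W.toCLM ∘L W.adj) ∘L K.1 ∘L K.1 ∈ diffCompactOps δ

/-- The `A_δ`-submodule `𝒳 = Im (W⋆ K² : H_{A_δ} → X)`. -/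
def diffSubmodule (W : AdjIsometry A X) (K : Adj A (StdMod A A)) : Submodule ℂ X :=
  (diffStdMod δ).map (W.adj ∘L K.1 ∘L K.1 : StdMod A A →L[ℂ] X).toLinearMap

end

variable (ρ : A →⋆ₙₐ[ℂ] Adj B Y) {𝒜 : NonUnitalStarSubalgebra ℂ A} (δ : 𝒜 →ₗ[ℂ] Adj B Y)

/-- The smallest C⋆-subalgebra of `ℒ(Y)` which contains `ρ a` and `δ a` for all `a` in `A_δ`. -/
def formsSubalgebra : NonUnitalStarSubalgebra ℂ (Adj B Y) :=
  (NonUnitalStarAlgebra.adjoin ℂ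
    ({T | ∃ a : (derivClosure δ).domain, T = ρ a} ∪
      {T | ∃ a : (derivClosure δ).domain, T = derivClosure δ a})).topologicalClosure

instance : IsClosed (formsSubalgebra ρ δ : Set (Adj B Y)) :=
  NonUnitalStarSubalgebra.isClosed_topologicalClosure _

/-- The C⋆-algebra `Ω_δ(A)` of continuous `δ`-forms. -/
def Forms : Type _ := formsSubalgebra ρ δ

instance : NonUnitalCStarAlgebra (Forms ρ δ) :=
  inferInstanceAs (NonUnitalCStarAlgebra (formsSubalgebra ρ δ))

instance : PartialOrder (Forms ρ δ) := CStarAlgebra.spectralOrder _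

instance : StarOrderedRing (Forms ρ δ) := CStarAlgebra.spectralOrderedRing _

/-- The inclusion of `Ω_δ(A)` into `ℒ(Y)`. -/
def Forms.incl : Forms ρ δ →⋆ₙₐ[ℂ] Adj B Y := NonUnitalStarSubalgebraClass.subtype (formsSubalgebra ρ δ)

lemma rep_mem_forms (h𝒜 : Dense (𝒜 : Set A)) (a : A) : ρ a ∈ formsSubalgebra ρ δ := by
  have hcl : IsClosed {a : A | ρ a ∈ formsSubalgebra ρ δ} := by
    have hc : Continuous ρ := AddMonoidHomClass.continuous_of_bound ρ 1 fun a => by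
      rw [one_mul]
      exact NonUnitalStarAlgHom.norm_apply_le ρ a
    have hF : IsClosed (formsSubalgebra ρ δ : Set (Adj B Y)) := inferInstance
    exact hF.preimage hc
  have hsub : (𝒜 : Set A) ⊆ {a : A | ρ a ∈ formsSubalgebra ρ δ} := fun a ha =>
    NonUnitalStarSubalgebra.le_topologicalClosure _
      (NonUnitalStarAlgebra.subset_adjoin ℂ _
        (Or.inl ⟨⟨a, (LinearPMap.le_closure _).1 ha⟩, rfl⟩))
  exact closure_minimal hsub hcl (h𝒜 a)

/-- `ρ`, as a `⋆`-homomorphism from `A` to `Ω_δ(A)`. -/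
def Forms.ofAlg (h𝒜 : Dense (𝒜 : Set A)) : A →⋆ₙₐ[ℂ] Forms ρ δ :=
  NonUnitalStarAlgHom.codRestrict ρ (formsSubalgebra ρ δ) (rep_mem_forms ρ δ h𝒜)

/-- The representation `A → ℒ(Ω_δ(A))`, `a ↦ (ω ↦ ρ a ω)`. -/
def Forms.rep (h𝒜 : Dense (𝒜 : Set A)) : A →⋆ₙₐ[ℂ] Adj (Forms ρ δ) (Forms ρ δ) :=
  leftMul.comp (Forms.ofAlg ρ δ h𝒜)

/-- The derivation, as a map from `A_δ` to `Ω_δ(A)`. -/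
def Forms.deriv : A →ₗ.[ℂ] Forms ρ δ where
  domain := (derivClosure δ).domain
  toFun := LinearMap.codRestrict (formsSubalgebra ρ δ).toNonUnitalSubalgebra.toSubmodule
    (derivClosure δ).toFun fun a =>
      NonUnitalStarSubalgebra.le_topologicalClosure _
        (NonUnitalStarAlgebra.subset_adjoin ℂ _ (Or.inr ⟨a, rfl⟩))

/-- `ξ ⊗ ω ↦ ξ ⊗ ω y` on the algebraic tensor product. -/
def Forms.preEval (h𝒜 : Dense (𝒜 : Set A)) (y : Y) :
    PreTensor X (Forms.rep ρ δ h𝒜) →ₗ[ℂ] PreTensor X ρ :=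
  LinearMap.lTensor X
    { toFun := fun ω : Forms ρ δ => (Forms.incl ρ δ ω).app y
      map_add' := fun ω ω' => by simp [Adj.app]
      map_smul' := fun c ω => by simp [Adj.app] }

variable {ρ δ} in
lemma Forms.form_eval (h𝒜 : Dense (𝒜 : Set A)) (y : Y)
    (s t : PreTensor X (Forms.rep ρ δ h𝒜)) :
    PreTensor.form X ρ (Forms.preEval ρ δ h𝒜 y s) (Forms.preEval ρ δ h𝒜 y t) =
      rinner B y ((Forms.incl ρ δ (PreTensor.form X (Forms.rep ρ δ h𝒜) s t)).app y) := by
  induction s using PreTensor.induction_on with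
  | zero => simp [rinner, Adj.app]
  | add s s' hs hs' => simp [rinner_add_right, hs, hs', Adj.app]
  | tmul ξ ω =>
    induction t using PreTensor.induction_on with
    | zero => simp [rinner, Adj.app]
    | add t t' ht ht' => simp [rinner_add_right, ht, ht', Adj.app]
    | tmul ξ' ω' =>
      change rinner B ((Forms.incl ρ δ ω).app y)
        ((ρ (rinner A ξ ξ')).app ((Forms.incl ρ δ ω').app y)) = _
      rw [Adj.adjoint, ← map_star]
      rfl

/-- The evaluation `X ⊗̂_A Ω_δ(A) → X ⊗̂_A Y`, `ξ ⊗ ω ↦ ξ ⊗ ω y`, at a vector `y` in `Y`. -/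
def Forms.eval (h𝒜 : Dense (𝒜 : Set A)) (y : Y) :
    IntTensor X (Forms.rep ρ δ h𝒜) →L[ℂ] IntTensor X ρ :=
  ((UniformSpace.Completion.toComplL : PreTensor X ρ →L[ℂ] IntTensor X ρ) ∘L
    (Forms.preEval ρ δ h𝒜 y).mkContinuous ‖y‖ fun t => by
      rw [← sq_le_sq₀ (norm_nonneg _) (by positivity), PreTensor.norm_sq, Forms.form_eval, mul_pow,
        PreTensor.norm_sq]
      refine (norm_rinner_le _ _).trans ?_
      have h := ContinuousLinearMap.le_opNorm
        (Forms.incl ρ δ (PreTensor.form X (Forms.rep ρ δ h𝒜) t t)).1 y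
      calc _ ≤ ‖y‖ * (‖PreTensor.form X (Forms.rep ρ δ h𝒜) t t‖ * ‖y‖) := by
            gcongr
            exact h
        _ = _ := by ring).extend UniformSpace.Completion.toComplL

lemma Forms.eval_tmul (h𝒜 : Dense (𝒜 : Set A)) (y : Y) (ξ : X) (ω : Forms ρ δ) :
    Forms.eval ρ δ h𝒜 y (IntTensor.tmul _ ξ ω) =
      IntTensor.tmul ρ ξ ((Forms.incl ρ δ ω).app y) :=
  ContinuousLinearMap.extend_eq _ UniformSpace.Completion.denseRange_coe
    (UniformSpace.Completion.isUniformInducing_coe _) (PreTensor.tmul _ ξ ω)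

/-- The Grassmann connection `∇_δ = (W⋆ ⊗ 1) δ W`, with values in `X ⊗̂_A Ω_δ(A)`, where
`δ {a n} = {δ (a n)}`. It is defined on all `ξ` for which `W ξ` lies in the domain of this `δ`. -/
def grassmann (h𝒜 : Dense (𝒜 : Set A)) (W : AdjIsometry A X) :
    X →ₗ.[ℂ] IntTensor X (Forms.rep ρ δ h𝒜) :=
  (adjointOf (Forms ρ δ) (W.tensorOne (Forms.rep ρ δ h𝒜))).toLinearMap.compPMap
    (precomp (diag A (Forms ρ δ) (Forms.deriv ρ δ)) W.toCLM.toLinearMap)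

/-- The symmetric lift `1 ⊗_∇ D = (W⋆ ⊗ 1) diag(D) (W ⊗ 1)`, with domain the set of all `σ` for
which `(W ⊗ 1) σ` lies in the domain of `diag(D)`. -/
def symLift (W : AdjIsometry A X) (D : Y →ₗ.[ℂ] Y) : IntTensor X ρ →ₗ.[ℂ] IntTensor X ρ :=
  (adjointOf B (W.tensorOne ρ)).toLinearMap.compPMap
    (precomp (diag B B D) (W.tensorOne ρ).toLinearMap)

end Derivation

end SymLift

end

open SymLift MulOpposite

/-!
The operator `W ⊗ 1` is isometric because `W` is. Since `W ξ = {⟪ζ k, ξ⟫}`, one has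
`⟪ζ k ⊗ y, σ⟫ = ⟪y, ((W ⊗ 1) σ) k⟫`, so the finite sums of vectors `ζ k ⊗ y k` are bounded by the
norm of `{y k}` (`AdjIsometry.norm_sum_tmul_sq_le`) and `{y k} ↦ ∑ ζ k ⊗ y k` is a bounded adjoint
(`AdjIsometry.hasSum_adjointOf_tensorOne`). This formula holds over `Y` and over `Ω_δ(A)` alike,
hence evaluation of forms at `η` intertwines the two operators `W⋆ ⊗ 1` (`eval_adjointOf`).
Right linearity and symmetry of `(W⋆ ⊗ 1) diag(D) (W ⊗ 1)` follow from those of `D`.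

For `ξ` in `𝒳` the point is that `W ξ` lies in `H_{A_δ}`. Since `D` is closed, the relation
`T = [D, ρ a]` is closed in `(a, T)` (`isClosed_isCommutatorPair`). So `δ` is closable, its
closure still consists of commutators with `D`, and it obeys the Leibniz rule. Now
`W ξ = W W⋆ K² a` with `a` in `H_{A_δ}`, and `W W⋆ K²` is a limit of finite matrices `m` over `𝒜` for
which `δ(m)` converges too. In `δ(m a) = δ(m) ρ(a) + ρ(m) δ(a)` the last term converges because
`‖ρ(m)‖ ≤ ‖m‖`: the algebra `M_n(A)` embeds into `ℒ(H_A)`, isometrically since injective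
`⋆`-homomorphisms are isometric, and `m ↦ ρ(m)` is a `⋆`-homomorphism on it
(`norm_matrixCLM_map_le`). Closedness of the closure of `δ` gives the claim
(`map_mem_diffStdMod`), and `D ρ(W ξ k) η = δ(W ξ k) η + ρ(W ξ k) D η` summed against `ζ k` is the
formula for `(1 ⊗_∇ D)(ξ ⊗ η)`.

The domain is then dense: it contains `ξ ⊗ η` for `ξ` in `𝒳` and `η` in the domain of `D`, and `𝒳` is
dense because `H_{A_δ}` is dense in `H_A` and `W⋆ K² W = (W⋆ K W)²` has dense range.
-/

noncomputable section

open scoped ComplexOrder TensorProduct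

set_option linter.unusedSectionVars false

namespace SymLift

/-! ### Coordinates in the standard module -/

section StdModule

variable {B Y : Type*} [NonUnitalCStarAlgebra B] [PartialOrder B] [StarOrderedRing B]
  [NormedAddCommGroup Y] [NormedSpace ℂ Y] [SMul Bᵐᵒᵖ Y] [CStarModule Bᵐᵒᵖ Y]

namespace StdMod

@[simp] lemma sum_apply {ι : Type*} (s : Finset ι) (f : ι → StdMod B Y) (n : ℕ) :
    (∑ i ∈ s, f i) n = ∑ i ∈ s, f i n := by
  classical
  induction s using Finset.induction_on with
  | empty => simp
  | insert i s hi ih => rw [Finset.sum_insert hi, Finset.sum_insert hi, add_apply, ih]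

variable (B Y) in
/-- The `k`-th coordinate as a bounded linear map on `Y^∞`. -/
def proj (k : ℕ) : StdMod B Y →L[ℂ] Y :=
  LinearMap.mkContinuous
    { toFun := fun x => x k
      map_add' := fun _ _ => rfl
      map_smul' := fun _ _ => rfl } 1 fun x => by
    rw [one_mul]
    exact norm_apply_le x k

@[simp] lemma proj_apply (k : ℕ) (x : StdMod B Y) : proj B Y k x = x k := rfl

variable (B Y) in
/-- The inclusion of `Y` as the `k`-th summand of `Y^∞`. -/
def single (k : ℕ) : Y →L[ℂ] StdMod B Y :=
  LinearMap.mkContinuous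
    { toFun := fun y => ⟨Pi.single k y, summable_of_ne_finset_zero (s := {k}) fun n hn => by
        rw [Pi.single_eq_of_ne (by simpa using hn)]
        simp [rinner]⟩
      map_add' := fun x y => Subtype.ext (Pi.single_add (f := fun _ => Y) k x y)
      map_smul' := fun c x => Subtype.ext (Pi.single_smul (f := fun _ => Y) k c x) } 1 fun y => by
    rw [one_mul]
    refine norm_le_of_sum_le _ (norm_nonneg _) fun s => ?_
    change ‖∑ n ∈ s, rinner B (Pi.single (M := fun _ => Y) k y n) (Pi.single (M := fun _ => Y) k y n)‖ ≤ _
    have h : ∀ n, rinner B (Pi.single (M := fun _ => Y) k y n) (Pi.single (M := fun _ => Y) k y n) =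
        if n = k then rinner B y y else 0 := by
      intro n
      split_ifs with hn
      · subst hn; simp
      · rw [Pi.single_eq_of_ne hn]; simp [rinner]
    simp only [h, Finset.sum_ite_eq']
    split_ifs
    · rw [norm_sq_rinner (B := B)]
    · simp

lemma single_apply (k n : ℕ) (y : Y) : single B Y k y n = if n = k then y else 0 := by
  exact Pi.single_apply (M := Y) k y n

lemma rinner_single_right (x : StdMod B Y) (k : ℕ) (y : Y) :
    rinner B x (single B Y k y) = rinner B (x k) y := by
  rw [rinner_def, tsum_eq_single k]
  · simp [single_apply]
  · intro n hn
    simp [single_apply, hn, rinner]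

lemma hasSum_single (x : StdMod B Y) : HasSum (fun k => single B Y k (x k)) x := by
  rw [HasSum, Metric.tendsto_nhds]
  intro ε hε
  obtain ⟨s, hs⟩ := summable_iff_vanishing_norm.1 (summable x x) ((ε / 2) ^ 2) (by positivity)
  filter_upwards [Filter.eventually_ge_atTop s] with t ht
  rw [dist_comm, dist_eq_norm]
  refine (norm_le_of_sum_le (C := ε / 2) _ (by positivity) fun u => ?_).trans_lt (by linarith)
  have h : ∀ n, rinner B ((x - ∑ k ∈ t, single B Y k (x k)) n)
      ((x - ∑ k ∈ t, single B Y k (x k)) n) = if n ∈ t then 0 else rinner B (x n) (x n) := by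
    intro n
    split_ifs with hn <;> simp [single_apply, hn, rinner]
  simp only [h]
  have hu : (∑ n ∈ u, if n ∈ t then 0 else rinner B (x n) (x n)) =
      ∑ n ∈ u \ t, rinner B (x n) (x n) := by
    rw [← Finset.filter_notMem_eq_sdiff, Finset.sum_filter]
    exact Finset.sum_congr rfl fun n _ => by by_cases hn : n ∈ t <;> simp [hn]
  rw [hu]
  exact (hs _ (Finset.disjoint_of_subset_right ht Finset.sdiff_disjoint)).le

end StdMod

end StdModule

/-! ### The operators `W ⊗ 1` and their adjoints -/

section TensorOne

variable {A B X Y : Type*}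
  [NonUnitalCStarAlgebra A] [PartialOrder A] [StarOrderedRing A]
  [NonUnitalCStarAlgebra B] [PartialOrder B] [StarOrderedRing B]
  [NormedAddCommGroup X] [NormedSpace ℂ X] [SMul Aᵐᵒᵖ X] [CStarModule Aᵐᵒᵖ X]
  [NormedAddCommGroup Y] [NormedSpace ℂ Y] [CompleteSpace Y] [SMul Bᵐᵒᵖ Y] [CStarModule Bᵐᵒᵖ Y]

lemma isAdjointPair_adjointOf {E F : Type*} [NormedAddCommGroup E] [NormedSpace ℂ E] [SMul Bᵐᵒᵖ E]
    [CStarModule Bᵐᵒᵖ E] [NormedAddCommGroup F] [NormedSpace ℂ F] [SMul Bᵐᵒᵖ F]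
    [CStarModule Bᵐᵒᵖ F] {T : E →L[ℂ] F} (h : ∃ S : F →L[ℂ] E, IsAdjointPair B T S) :
    IsAdjointPair B T (adjointOf B T) := by
  rw [adjointOf, dif_pos h]
  exact h.choose_spec

/-- An adjointable map is linear over the right action. -/
lemma IsAdjointPair.map_act {E F : Type*} [NormedAddCommGroup E] [NormedSpace ℂ E] [SMul Bᵐᵒᵖ E]
    [CStarModule Bᵐᵒᵖ E] [NormedAddCommGroup F] [NormedSpace ℂ F] [SMul Bᵐᵒᵖ F]
    [CStarModule Bᵐᵒᵖ F] {T : E → F} {S : F → E} (h : IsAdjointPair B T S) (b : B) (x : E) :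
    T (op b • x) = op b • T x :=
  ext_rinner' (B := B) fun z => by
    rw [← h.symm, rinner_act_right, rinner_act_right, ← h.symm]

/-- The bounded linear map `y ↦ ⟪x, y⟫`. -/
def rinnerL (B : Type*) {E : Type*} [NonUnitalCStarAlgebra B] [PartialOrder B] [StarOrderedRing B]
    [NormedAddCommGroup E] [NormedSpace ℂ E] [SMul Bᵐᵒᵖ E] [CStarModule Bᵐᵒᵖ E] (x : E) :
    E →L[ℂ] B :=
  LinearMap.mkContinuous
    { toFun := fun y => rinner B x y
      map_add' := rinner_add_right x
      map_smul' := fun c y => rinner_smul_right c x y } ‖x‖ fun y => norm_rinner_le x y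

@[simp] lemma rinnerL_apply {E : Type*} [NormedAddCommGroup E] [NormedSpace ℂ E] [SMul Bᵐᵒᵖ E]
    [CStarModule Bᵐᵒᵖ E] (x y : E) : rinnerL B x y = rinner B x y := rfl

variable {ρ : A →⋆ₙₐ[ℂ] Adj B Y}

lemma rinner_tmul_tmul (x x' : X) (y y' : Y) :
    rinner B (IntTensor.tmul ρ x y) (IntTensor.tmul ρ x' y') =
      rinner B y ((ρ (rinner A x x')).app y') :=
  congrArg unop (IntTensor.inner_coe (PreTensor.tmul ρ x y) (PreTensor.tmul ρ x' y'))

lemma norm_tmul_le (x : X) (y : Y) : ‖IntTensor.tmul ρ x y‖ ≤ ‖x‖ * ‖y‖ := by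
  rw [← sq_le_sq₀ (norm_nonneg _) (by positivity), norm_sq_rinner (B := B), rinner_tmul_tmul,
    mul_pow, norm_sq_rinner (B := A) x]
  calc _ ≤ ‖y‖ * (‖rinner A x x‖ * ‖y‖) := by
        refine (norm_rinner_le _ _).trans ?_
        gcongr
        refine (ContinuousLinearMap.le_opNorm _ _).trans ?_
        gcongr
        exact NonUnitalStarAlgHom.norm_apply_le ρ _
    _ = _ := by ring

variable (ρ) in
/-- `x ⊗ y` as a jointly bounded bilinear map into the interior tensor product. -/
def tmulL : X →L[ℂ] Y →L[ℂ] IntTensor X ρ :=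
  LinearMap.mkContinuous₂
    (((TensorProduct.mk ℂ X Y).compr₂
      (UniformSpace.Completion.toComplL : PreTensor X ρ →L[ℂ] IntTensor X ρ).toLinearMap)) 1
    fun x y => by
      rw [one_mul]
      exact norm_tmul_le x y

/-- The span of the elementary tensors is dense. -/
lemma dense_span_tmul :
    Dense (Submodule.span ℂ {t : IntTensor X ρ | ∃ x y, t = IntTensor.tmul ρ x y} :
      Set (IntTensor X ρ)) := by
  refine UniformSpace.Completion.denseRange_coe.mono ?_
  rintro _ ⟨t, rfl⟩
  induction t using PreTensor.induction_on with
  | zero => exact Submodule.zero_mem _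
  | tmul x y => exact Submodule.subset_span ⟨x, y, rfl⟩
  | add s t hs ht =>
    rw [UniformSpace.Completion.coe_add]
    exact Submodule.add_mem _ hs ht

/-- A subspace which contains `x ⊗ y` for all `x` and `y` in dense sets is dense. -/
lemma dense_of_tmul_mem (S : Submodule ℂ (IntTensor X ρ)) {U : Set X} {V : Set Y} (hU : Dense U)
    (hV : Dense V) (h : ∀ x ∈ U, ∀ y ∈ V, IntTensor.tmul ρ x y ∈ S) :
    Dense (S : Set (IntTensor X ρ)) := by
  have hcl : IsClosed {p : X × Y | tmulL ρ p.1 p.2 ∈ S.topologicalClosure} :=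
    S.isClosed_topologicalClosure.preimage (by fun_prop)
  have hall : ∀ p : X × Y, tmulL ρ p.1 p.2 ∈ S.topologicalClosure := fun p =>
    closure_minimal (fun q (hq : q ∈ U ×ˢ V) => S.le_topologicalClosure (h _ hq.1 _ hq.2)) hcl
      (hU.prod hV p)
  have hspan : Submodule.span ℂ {t : IntTensor X ρ | ∃ x y, t = IntTensor.tmul ρ x y} ≤
      S.topologicalClosure := by
    rw [Submodule.span_le]
    rintro _ ⟨x, y, rfl⟩
    exact hall (x, y)
  exact dense_closure.1 ((dense_span_tmul (ρ := ρ)).mono hspan)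

/-- Bounded operators which agree on elementary tensors are equal. -/
lemma IntTensor.clm_ext {F : Type*} [NormedAddCommGroup F] [NormedSpace ℂ F]
    {S T : IntTensor X ρ →L[ℂ] F}
    (h : ∀ x y, S (IntTensor.tmul ρ x y) = T (IntTensor.tmul ρ x y)) (t : IntTensor X ρ) :
    S t = T t := by
  have := ContinuousLinearMap.ext_on (dense_span_tmul (ρ := ρ)) (f := S) (g := T) (by
    rintro _ ⟨x, y, rfl⟩
    exact h x y)
  rw [this]

namespace AdjIsometry

variable (W : AdjIsometry A X)

lemma tensorOne_coe (t : PreTensor X ρ) :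
    W.tensorOne ρ (t : UniformSpace.Completion (PreTensor X ρ)) = W.preTensorOne ρ t :=
  ContinuousLinearMap.extend_eq _ UniformSpace.Completion.denseRange_coe
    (UniformSpace.Completion.isUniformInducing_coe _) t

/-- `W ⊗ 1` preserves inner products. -/
lemma rinner_tensorOne (s t : IntTensor X ρ) :
    rinner B (W.tensorOne ρ s) (W.tensorOne ρ t) = rinner B s t := by
  induction s, t using UniformSpace.Completion.induction_on₂ with
  | hp =>
    refine isClosed_eq ?_ continuous_rinner
    exact continuous_rinner.comp (((W.tensorOne ρ).continuous.comp continuous_fst).prodMk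
      ((W.tensorOne ρ).continuous.comp continuous_snd))
  | ih s t =>
    rw [tensorOne_coe, tensorOne_coe, rinner_preTensorOne]
    exact (congrArg unop (IntTensor.inner_coe s t)).symm

lemma norm_tensorOne (t : IntTensor X ρ) : ‖W.tensorOne ρ t‖ = ‖t‖ := by
  rw [← sq_eq_sq₀ (norm_nonneg _) (norm_nonneg _), norm_sq_rinner (B := B), rinner_tensorOne,
    norm_sq_rinner (B := B)]

variable {W} {ζ : ℕ → X}

lemma rinner_tmul_seq (hζ : ∀ ξ k, W.toCLM ξ k = rinner A (ζ k) ξ) (k : ℕ) (y : Y)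
    (t : IntTensor X ρ) :
    rinner B (IntTensor.tmul ρ (ζ k) y) t = rinner B y (W.tensorOne ρ t k) :=
  IntTensor.clm_ext (S := rinnerL B (IntTensor.tmul ρ (ζ k) y))
    (T := rinnerL B y ∘L StdMod.proj B Y k ∘L W.tensorOne ρ) (fun x y' => by
      simp [rinner_tmul_tmul, tensorOne_tmul, hζ]) t

/-- The vectors `ζ k ⊗ y k` are controlled by `y` because their sum is `(W ⊗ 1)⋆ y`, and `W ⊗ 1`
is isometric. -/
lemma norm_sum_tmul_sq_le (hζ : ∀ ξ k, W.toCLM ξ k = rinner A (ζ k) ξ) (y : ℕ → Y)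
    (s : Finset ℕ) :
    ‖∑ k ∈ s, IntTensor.tmul ρ (ζ k) (y k)‖ ^ 2 ≤ ‖∑ k ∈ s, rinner B (y k) (y k)‖ := by
  set t := ∑ k ∈ s, IntTensor.tmul ρ (ζ k) (y k) with ht
  have h1 : rinner B t t = ∑ k ∈ s, rinner B (y k) (W.tensorOne ρ t k) := by
    conv_lhs => enter [2]; rw [ht]
    rw [rinner_sum_left]
    exact Finset.sum_congr rfl fun k _ => rinner_tmul_seq hζ k (y k) t
  have h2 := norm_sum_rinner_sq_le (B := B) s y (W.tensorOne ρ t)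
  have h3 := StdMod.norm_sum_le (W.tensorOne ρ t) s
  rw [norm_tensorOne] at h3
  rw [← h1, ← norm_sq_rinner] at h2
  rcases (sq_nonneg ‖t‖).eq_or_lt with h0 | h0
  · rw [← h0]
    exact norm_nonneg _
  · have h4 : (‖t‖ ^ 2) ^ 2 ≤ ‖∑ k ∈ s, rinner B (y k) (y k)‖ * ‖t‖ ^ 2 :=
      h2.trans (mul_le_mul_of_nonneg_left h3 (norm_nonneg _))
    rw [sq (‖t‖ ^ 2)] at h4
    exact le_of_mul_le_mul_right h4 h0

lemma summable_tmul_seq (hζ : ∀ ξ k, W.toCLM ξ k = rinner A (ζ k) ξ) (y : StdMod B Y) :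
    Summable fun k => IntTensor.tmul ρ (ζ k) (y k) := by
  rw [summable_iff_vanishing_norm]
  intro ε hε
  obtain ⟨s, hs⟩ := summable_iff_vanishing_norm.1 (StdMod.summable y y) (ε ^ 2) (by positivity)
  refine ⟨s, fun t ht => lt_of_pow_lt_pow_left₀ 2 hε.le ?_⟩
  exact (norm_sum_tmul_sq_le hζ y t).trans_lt (hs t ht)

/-- If `W ξ = {⟪ζ k, ξ⟫}` then `y ↦ ∑ ζ k ⊗ y k` is a bounded adjoint of `W ⊗ 1`. -/
lemma exists_adjoint_tensorOne (hζ : ∀ ξ k, W.toCLM ξ k = rinner A (ζ k) ξ) :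
    ∃ S : StdMod B Y →L[ℂ] IntTensor X ρ, IsAdjointPair B (W.tensorOne ρ) S ∧
      ∀ y : StdMod B Y, HasSum (fun k => IntTensor.tmul ρ (ζ k) (y k)) (S y) := by
  let S : StdMod B Y →L[ℂ] IntTensor X ρ := LinearMap.mkContinuous
    { toFun := fun y => ∑' k, IntTensor.tmul ρ (ζ k) (y k)
      map_add' := fun y z => by
        rw [← (summable_tmul_seq hζ y).tsum_add (summable_tmul_seq hζ z)]
        exact tsum_congr fun k => (tmulL ρ (ζ k)).map_add _ _
      map_smul' := fun c y => by
        rw [RingHom.id_apply, ← (summable_tmul_seq hζ y).tsum_const_smul]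
        exact tsum_congr fun k => (tmulL ρ (ζ k)).map_smul _ _ } 1 fun y => by
    rw [one_mul]
    refine le_of_tendsto (summable_tmul_seq hζ y).hasSum.norm (Filter.Eventually.of_forall
      fun s => ?_)
    rw [← sq_le_sq₀ (norm_nonneg _) (norm_nonneg _)]
    exact (norm_sum_tmul_sq_le hζ y s).trans (StdMod.norm_sum_le y s)
  have hS : ∀ y : StdMod B Y, HasSum (fun k => IntTensor.tmul ρ (ζ k) (y k)) (S y) :=
    fun y => (summable_tmul_seq hζ y).hasSum
  refine ⟨S, fun t y => ?_, hS⟩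
  have h1 : HasSum (fun k => rinner B t (IntTensor.tmul ρ (ζ k) (y k))) (rinner B t (S y)) :=
    (hS y).mapL (rinnerL B t)
  rw [← h1.tsum_eq, StdMod.rinner_def]
  refine tsum_congr fun k => ?_
  rw [← star_rinner, ← rinner_tmul_seq hζ, star_rinner]

lemma isAdjointPair_tensorOne (hζ : ∀ ξ k, W.toCLM ξ k = rinner A (ζ k) ξ) :
    IsAdjointPair B (W.tensorOne ρ) (adjointOf B (W.tensorOne ρ)) := by
  obtain ⟨S, hS, -⟩ := exists_adjoint_tensorOne (ρ := ρ) hζ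
  exact isAdjointPair_adjointOf ⟨S, hS⟩

lemma hasSum_adjointOf_tensorOne (hζ : ∀ ξ k, W.toCLM ξ k = rinner A (ζ k) ξ)
    (y : StdMod B Y) :
    HasSum (fun k => IntTensor.tmul ρ (ζ k) (y k)) (adjointOf B (W.tensorOne ρ) y) := by
  obtain ⟨S, hS, hsum⟩ := exists_adjoint_tensorOne (ρ := ρ) hζ
  rw [(isAdjointPair_adjointOf ⟨S, hS⟩).ext hS]
  exact hsum y

lemma adjointOf_tensorOne_apply (hζ : ∀ ξ k, W.toCLM ξ k = rinner A (ζ k) ξ)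
    (t : IntTensor X ρ) : adjointOf B (W.tensorOne ρ) (W.tensorOne ρ t) = t :=
  ext_rinner' (B := B) fun s => by
    rw [← isAdjointPair_tensorOne hζ, rinner_tensorOne]

end AdjIsometry

end TensorOne

/-! ### Selfadjoint operators on Hilbert modules -/

section SelfAdjoint

variable {B Y : Type*} [NonUnitalCStarAlgebra B] [PartialOrder B] [StarOrderedRing B]
  [NormedAddCommGroup Y] [NormedSpace ℂ Y] [SMul Bᵐᵒᵖ Y] [CStarModule Bᵐᵒᵖ Y]

namespace IsSelfAdjointOp

variable {D : Y →ₗ.[ℂ] Y}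

lemma mem_graph_iff (hD : IsSelfAdjointOp B D) {p : Y × Y} :
    p ∈ D.graph ↔ ∀ x : D.domain, rinner B (D x) p.1 = rinner B (x : Y) p.2 :=
  Set.ext_iff.1 hD.2 p

lemma rinner_eq_of_mem_graph (hD : IsSelfAdjointOp B D) {p q : Y × Y} (hp : p ∈ D.graph)
    (hq : q ∈ D.graph) : rinner B p.2 q.1 = rinner B p.1 q.2 := by
  obtain ⟨x, h1, h2⟩ := (LinearPMap.mem_graph_iff _).1 hp
  rw [← h1, ← h2]
  exact hD.mem_graph_iff.1 hq x

lemma isClosed_graph (hD : IsSelfAdjointOp B D) : IsClosed (D.graph : Set (Y × Y)) := by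
  rw [hD.2, adjointGraph]
  simp only [Set.ofPred_forall]
  refine isClosed_iInter fun x => isClosed_eq ?_ ?_
  · exact continuous_rinner.comp (by fun_prop : Continuous fun p : Y × Y => (D x, p.1))
  · exact continuous_rinner.comp (by fun_prop : Continuous fun p : Y × Y => ((x : Y), p.2))

/-- A selfadjoint operator is linear over the right action, as every adjoint is. -/
lemma act_mem_graph (hD : IsSelfAdjointOp B D) {p : Y × Y} (hp : p ∈ D.graph) (b : B) :
    (op b • p.1, op b • p.2) ∈ D.graph :=
  hD.mem_graph_iff.2 fun z => by
    rw [rinner_act_right, rinner_act_right, hD.mem_graph_iff.1 hp z]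

end IsSelfAdjointOp

end SelfAdjoint

lemma mk_mem_graph_iff {E F : Type*} [AddCommGroup E] [Module ℂ E] [AddCommGroup F] [Module ℂ F]
    {f : E →ₗ.[ℂ] F} {x : E} {y : F} :
    (x, y) ∈ f.graph ↔ ∃ h : x ∈ f.domain, f ⟨x, h⟩ = y := by
  rw [LinearPMap.mem_graph_iff]
  constructor
  · rintro ⟨z, rfl, rfl⟩
    exact ⟨z.2, rfl⟩
  · rintro ⟨h, rfl⟩
    exact ⟨⟨x, h⟩, rfl, rfl⟩

/-! ### The closure of the derivation -/

section Closure

variable {A B Y : Type*}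
  [NonUnitalCStarAlgebra A] [PartialOrder A] [StarOrderedRing A]
  [NonUnitalCStarAlgebra B] [PartialOrder B] [StarOrderedRing B]
  [NormedAddCommGroup Y] [NormedSpace ℂ Y] [CompleteSpace Y] [SMul Bᵐᵒᵖ Y] [CStarModule Bᵐᵒᵖ Y]
  {D : Y →ₗ.[ℂ] Y} {ρ : A →⋆ₙₐ[ℂ] Adj B Y} {𝒜 : NonUnitalStarSubalgebra ℂ A}
  {δ : 𝒜 →ₗ[ℂ] Adj B Y}

lemma continuous_rep (ρ : A →⋆ₙₐ[ℂ] Adj B Y) : Continuous ρ :=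
  AddMonoidHomClass.continuous_of_bound ρ 1 fun a => by
    rw [one_mul]
    exact NonUnitalStarAlgHom.norm_apply_le ρ a

lemma continuous_app (y : Y) : Continuous fun T : Adj B Y => T.app y :=
  (ContinuousLinearMap.apply ℂ Y y).continuous.comp continuous_subtype_val

/-- The pair `(a, T)` satisfies: `ρ a` preserves the domain of `D`, and `T = [D, ρ a]` there. It is
written in terms of the graph of `D`, as `D (ρ a η) = T η + ρ a (D η)`, so that it passes to limits
in `(a, T)`. -/
def IsCommutatorPair (D : Y →ₗ.[ℂ] Y) (ρ : A →⋆ₙₐ[ℂ] Adj B Y) (p : A × Adj B Y) : Prop :=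
  ∀ η : D.domain, ((ρ p.1).app η, p.2.app η + (ρ p.1).app (D η)) ∈ D.graph

lemma isClosed_isCommutatorPair (hD : IsSelfAdjointOp B D) :
    IsClosed {p : A × Adj B Y | IsCommutatorPair D ρ p} := by
  simp only [IsCommutatorPair, Set.ofPred_forall]
  refine isClosed_iInter fun η => hD.isClosed_graph.preimage ?_
  have h1 : ∀ y : Y, Continuous fun p : A × Adj B Y => (ρ p.1).app y := fun y =>
    (continuous_app y).comp ((continuous_rep ρ).comp continuous_fst)
  exact (h1 _).prodMk (((continuous_app _).comp continuous_snd).add (h1 _))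

/-- `[D, ρ a]` determines its bounded extension, since the domain of `D` is dense. -/
lemma IsCommutatorPair.unique (hD : IsSelfAdjointOp B D) {a : A} {S T : Adj B Y}
    (hS : IsCommutatorPair D ρ (a, S)) (hT : IsCommutatorPair D ρ (a, T)) : S = T := by
  have h : ∀ η : D.domain, S.app η = T.app η := fun η =>
    add_right_cancel (D.mem_graph_snd_inj (hS η) (hT η) rfl)
  exact Subtype.ext (ContinuousLinearMap.coeFn_injective
    (Continuous.ext_on hD.1 S.1.continuous T.1.continuous fun η hη => h ⟨η, hη⟩))

lemma IsCommutatorPair.mul {a b : A} {S T : Adj B Y} (hS : IsCommutatorPair D ρ (b, S))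
    (hT : IsCommutatorPair D ρ (a, T)) :
    IsCommutatorPair D ρ (b * a, S * ρ a + ρ b * T) := fun η => by
  obtain ⟨h, e⟩ := mk_mem_graph_iff.1 (hT η)
  have h2 := hS ⟨_, h⟩
  rw [e] at h2
  convert h2 using 2
  · simp [Adj.app]
  · simp [Adj.app, add_assoc]

lemma isCommutatorPair_of_deriv
    (hδ : ∀ (a : 𝒜) (η : D.domain), ∃ h : (ρ a).app η ∈ D.domain,
      (δ a).app η = D ⟨(ρ a).app η, h⟩ - (ρ a).app (D η)) (a : 𝒜) :
    IsCommutatorPair D ρ ((a : A), δ a) := fun η => by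
  obtain ⟨h, e⟩ := hδ a η
  exact mk_mem_graph_iff.2 ⟨h, by rw [e]; abel⟩

lemma isCommutatorPair_of_mem_closure (hD : IsSelfAdjointOp B D)
    (hδ : ∀ a : 𝒜, IsCommutatorPair D ρ ((a : A), δ a))
    {p : A × Adj B Y}
    (hp : p ∈ (LinearPMap.mk 𝒜.toNonUnitalSubalgebra.toSubmodule δ).graph.topologicalClosure) :
    IsCommutatorPair D ρ p := by
  refine closure_minimal ?_ (isClosed_isCommutatorPair (ρ := ρ) hD) hp
  intro p hp
  obtain ⟨a, h1, h2⟩ := (LinearPMap.mem_graph_iff _).1 hp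
  have := hδ a
  rwa [show ((a : A), δ a) = p from Prod.ext h1 h2] at this

/-- The derivation is closable, because the commutators with the closed operator `D` are. -/
lemma isClosable_deriv (hD : IsSelfAdjointOp B D)
    (hδ : ∀ a : 𝒜, IsCommutatorPair D ρ ((a : A), δ a)) :
    (LinearPMap.mk 𝒜.toNonUnitalSubalgebra.toSubmodule δ).IsClosable := by
  refine ⟨_, (Submodule.toLinearPMap_graph_eq _ fun p hp h0 => ?_).symm⟩
  have h1 : IsCommutatorPair D ρ (0, p.2) := by
    rw [← h0]
    exact isCommutatorPair_of_mem_closure hD hδ hp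
  refine h1.unique hD fun η => ?_
  simp only [map_zero, Adj.app, ZeroMemClass.coe_zero, zero_apply, add_zero]
  exact zero_mem D.graph

lemma isClosed_graph_derivClosure (hD : IsSelfAdjointOp B D)
    (hδ : ∀ a : 𝒜, IsCommutatorPair D ρ ((a : A), δ a)) :
    IsClosed ((derivClosure δ).graph : Set (A × Adj B Y)) :=
  (isClosable_deriv hD hδ).closure_isClosed

lemma isCommutatorPair_derivClosure (hD : IsSelfAdjointOp B D)
    (hδ : ∀ a : 𝒜, IsCommutatorPair D ρ ((a : A), δ a))
    (a : (derivClosure δ).domain) :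
    IsCommutatorPair D ρ ((a : A), derivClosure δ a) := by
  refine isCommutatorPair_of_mem_closure hD hδ ?_
  rw [(isClosable_deriv hD hδ).graph_closure_eq_closure_graph]
  exact LinearPMap.mem_graph _ a

/-- `A_δ` is a left `𝒜`-module and the closure of the derivation obeys the Leibniz rule. -/
lemma mul_mem_graph_derivClosure (hD : IsSelfAdjointOp B D)
    (hδ : ∀ a : 𝒜, IsCommutatorPair D ρ ((a : A), δ a))
    (b : 𝒜) {p : A × Adj B Y} (hp : p ∈ (derivClosure δ).graph) :
    ((b : A) * p.1, δ b * ρ p.1 + ρ b * p.2) ∈ (derivClosure δ).graph := by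
  have key : ∀ p ∈ (LinearPMap.mk 𝒜.toNonUnitalSubalgebra.toSubmodule δ).graph.topologicalClosure,
      ((b : A) * p.1, δ b * ρ p.1 + ρ b * p.2) ∈
        (LinearPMap.mk 𝒜.toNonUnitalSubalgebra.toSubmodule δ).graph.topologicalClosure := by
    intro p hp
    have hc : Continuous fun p : A × Adj B Y => ((b : A) * p.1, δ b * ρ p.1 + ρ b * p.2) := by
      have := continuous_rep ρ
      fun_prop
    refine closure_minimal (fun q hq => ?_) ((Submodule.isClosed_topologicalClosure _).preimage hc) hp
    obtain ⟨c, h1, h2⟩ := (LinearPMap.mem_graph_iff _).1 hq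
    have hbc : δ (b * c) = δ b * ρ c + ρ b * δ c :=
      (hδ (b * c)).unique hD
        ((hδ b).mul (hδ c))
    refine Submodule.le_topologicalClosure _ ((LinearPMap.mem_graph_iff _).2 ⟨b * c, ?_, ?_⟩)
    · change (b : A) * c = b * q.1
      rw [← h1]
    · change δ (b * c) = _
      rw [hbc]
      dsimp only
      rw [← h1, ← h2]
      rfl
  unfold derivClosure at hp ⊢
  rw [← (isClosable_deriv hD hδ).graph_closure_eq_closure_graph] at hp ⊢
  exact key p hp

lemma coe_mem_derivClosure (a : 𝒜) : (a : A) ∈ (derivClosure δ).domain :=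
  (LinearPMap.le_closure _).1 a.2

end Closure

/-! ### Finite matrices as operators on the standard module -/

section MatrixOperators

variable {A C : Type*}
  [NonUnitalCStarAlgebra A] [PartialOrder A] [StarOrderedRing A]
  [NonUnitalCStarAlgebra C] [PartialOrder C] [StarOrderedRing C] {n : ℕ}

/-- The operator on `H_C` which multiplies the first `n` coordinates by the matrix `m`. -/
def matrixCLM (m : Matrix (Fin n) (Fin n) C) : StdMod C C →L[ℂ] StdMod C C :=
  ∑ i : Fin n, ∑ j : Fin n,
    StdMod.single C C i ∘L ContinuousLinearMap.mul ℂ C (m i j) ∘L StdMod.proj C C j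

lemma matrixCLM_apply (m : Matrix (Fin n) (Fin n) C) (x : StdMod C C) (k : ℕ) :
    matrixCLM m x k = if h : k < n then ∑ j : Fin n, m ⟨k, h⟩ j * x j else 0 := by
  have h1 : matrixCLM m x k =
      ∑ i : Fin n, if k = i then ∑ j : Fin n, m i j * x j else 0 := by
    simp only [matrixCLM, sum_apply, ContinuousLinearMap.comp_apply,
      StdMod.sum_apply, StdMod.single_apply, ContinuousLinearMap.mul_apply', StdMod.proj_apply]
    refine Finset.sum_congr rfl fun i _ => ?_
    split_ifs <;> simp
  rw [h1]
  split_ifs with h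
  · rw [Finset.sum_eq_single ⟨k, h⟩]
    · simp
    · intro i _ hi
      rw [if_neg]
      rintro rfl
      exact hi rfl
    · simp
  · refine Finset.sum_eq_zero fun i _ => if_neg ?_
    rintro rfl
    exact h i.2

lemma matrixCLM_apply_fin (m : Matrix (Fin n) (Fin n) C) (x : StdMod C C) (k : Fin n) :
    matrixCLM m x k = ∑ j : Fin n, m k j * x j := by
  rw [matrixCLM_apply, dif_pos k.2]

lemma matrixCLM_apply_of_le (m : Matrix (Fin n) (Fin n) C) (x : StdMod C C) {k : ℕ} (h : n ≤ k) :
    matrixCLM m x k = 0 := by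
  rw [matrixCLM_apply, dif_neg h.not_gt]

lemma IsMatrixOp.eq_matrixCLM {m : Matrix (Fin n) (Fin n) C} {T : StdMod C C →L[ℂ] StdMod C C}
    (h : IsMatrixOp m T) : T = matrixCLM m := by
  ext x k
  rw [h x k, matrixCLM_apply]

lemma StdMod.ext_fin {x y : StdMod C C} (h : ∀ k : Fin n, x k = y k)
    (h' : ∀ k, n ≤ k → x k = y k) : x = y :=
  StdMod.ext fun k => by
    rcases lt_or_ge k n with hk | hk
    · exact h ⟨k, hk⟩
    · exact h' k hk

lemma rinner_matrixCLM (m : Matrix (Fin n) (Fin n) C) (x y : StdMod C C) :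
    rinner C x (matrixCLM m y) = ∑ i : Fin n, ∑ j : Fin n, star (x i) * (m i j * y j) := by
  simp only [matrixCLM, sum_apply, rinner_sum_right]
  refine Finset.sum_congr rfl fun i _ => Finset.sum_congr rfl fun j _ => ?_
  exact StdMod.rinner_single_right x i _

lemma isAdjointPair_matrixCLM (m : Matrix (Fin n) (Fin n) C) :
    IsAdjointPair C (matrixCLM m) (matrixCLM m.conjTranspose) := fun x y => by
  rw [← star_rinner, rinner_matrixCLM, rinner_matrixCLM, star_sum, Finset.sum_comm]
  refine Finset.sum_congr rfl fun j _ => ?_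
  rw [star_sum]
  refine Finset.sum_congr rfl fun i _ => ?_
  simp [mul_assoc]

variable (C n) in
/-- The `⋆`-homomorphism `M_n(C) → ℒ(H_C)`. -/
def matrixHom : CStarMatrix (Fin n) (Fin n) C →⋆ₙₐ[ℂ] Adj C (StdMod C C) where
  toFun m := ⟨matrixCLM (CStarMatrix.ofMatrix.symm m), _, isAdjointPair_matrixCLM _⟩
  map_smul' c m := Subtype.ext <| ContinuousLinearMap.ext fun x => StdMod.ext_fin (n := n)
    (fun k => by
      change matrixCLM _ x k = c • matrixCLM _ x k
      simp only [matrixCLM_apply_fin, Finset.smul_sum]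
      exact Finset.sum_congr rfl fun j _ => smul_mul_assoc c _ _)
    (fun k hk => by
      change matrixCLM _ x k = c • matrixCLM _ x k
      simp [matrixCLM_apply_of_le _ _ hk])
  map_zero' := Subtype.ext <| ContinuousLinearMap.ext fun x => StdMod.ext_fin (n := n)
    (fun k => by
      change matrixCLM _ x k = 0
      rw [matrixCLM_apply_fin]
      exact Finset.sum_eq_zero fun j _ => zero_mul _)
    (fun k hk => matrixCLM_apply_of_le _ _ hk)
  map_add' m m' := Subtype.ext <| ContinuousLinearMap.ext fun x => StdMod.ext_fin (n := n)
    (fun k => by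
      change matrixCLM _ x k = matrixCLM _ x k + matrixCLM _ x k
      simp only [matrixCLM_apply_fin, ← Finset.sum_add_distrib]
      exact Finset.sum_congr rfl fun j _ => add_mul _ _ _)
    (fun k hk => by
      change matrixCLM _ x k = matrixCLM _ x k + matrixCLM _ x k
      simp [matrixCLM_apply_of_le _ _ hk])
  map_mul' m m' := Subtype.ext <| ContinuousLinearMap.ext fun x => StdMod.ext_fin (n := n)
    (fun k => by
      change matrixCLM _ x k = matrixCLM _ (matrixCLM _ x) k
      simp only [matrixCLM_apply_fin, Finset.mul_sum]
      rw [Finset.sum_comm]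
      refine Finset.sum_congr rfl fun j _ => ?_
      simp only [← mul_assoc, ← Finset.sum_mul]
      congr 1)
    (fun k hk => by
      change matrixCLM _ x k = matrixCLM _ (matrixCLM _ x) k
      simp [matrixCLM_apply_of_le _ _ hk])
  map_star' m := Adj.ext' fun x y => by
    rw [← Adj.adjoint]
    exact (isAdjointPair_matrixCLM _ x y).symm

/-- Testing on `m i j⋆` in coordinate `j` replaces the unit which `C` may lack. -/
lemma matrixHom_injective : Function.Injective (matrixHom C n) := by
  rw [injective_iff_map_eq_zero]
  intro m hm
  ext i j
  have h1 := congrArg (fun T : Adj C (StdMod C C) => T.app (StdMod.single C C j (star (m i j))) i) hm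
  change matrixCLM _ _ (i : ℕ) = 0 at h1
  rw [matrixCLM_apply_fin, Finset.sum_eq_single j] at h1
  · simp only [StdMod.single_apply, if_true] at h1
    exact (CStarRing.mul_star_self_eq_zero_iff _).1 h1
  · intro k _ hk
    rw [StdMod.single_apply, if_neg (fun h => hk (Fin.ext h)), mul_zero]
  · simp

/-- Applying a `⋆`-homomorphism to the entries of a finite matrix does not increase its norm as an
operator on the standard module: both norms are compared with the C⋆-norm of `M_n(A)`. -/
lemma norm_matrixCLM_map_le (φ : A →⋆ₙₐ[ℂ] C) (m : Matrix (Fin n) (Fin n) A) :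
    ‖matrixCLM (m.map φ)‖ ≤ ‖matrixCLM m‖ := by
  have h1 := NonUnitalStarAlgHom.norm_apply_le
    ((matrixHom C n).comp (CStarMatrix.mapₙₐ φ)) (CStarMatrix.ofMatrix m)
  have h2 := NonUnitalStarAlgHom.norm_map (matrixHom A n) matrixHom_injective
    (CStarMatrix.ofMatrix m)
  rw [← h2] at h1
  exact h1

/-- The `N × N` matrix with the entries of `m` where these exist, and zeros elsewhere. -/
def resize {R : Type*} [Zero R] (N : ℕ) (m : Matrix (Fin n) (Fin n) R) :
    Matrix (Fin N) (Fin N) R :=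
  Matrix.of fun i j => if h : (i : ℕ) < n ∧ (j : ℕ) < n then m ⟨i, h.1⟩ ⟨j, h.2⟩ else 0

lemma matrixCLM_resize {N : ℕ} (hN : n ≤ N) (m : Matrix (Fin n) (Fin n) C) :
    matrixCLM (resize N m) = matrixCLM m := by
  ext x k
  rw [matrixCLM_apply, matrixCLM_apply]
  by_cases hk : k < n
  · rw [dif_pos hk, dif_pos (hk.trans_le hN)]
    let g : ℕ → C := fun j => if h : j < n then m ⟨k, hk⟩ ⟨j, h⟩ * x j else 0
    have e1 : ∑ j : Fin N, resize N m ⟨k, hk.trans_le hN⟩ j * x j = ∑ j ∈ Finset.range N, g j := by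
      rw [← Fin.sum_univ_eq_sum_range]
      refine Finset.sum_congr rfl fun j _ => ?_
      by_cases hj : (j : ℕ) < n <;> simp [resize, g, hk, hj]
    have e2 : ∑ j : Fin n, m ⟨k, hk⟩ j * x j = ∑ j ∈ Finset.range n, g j := by
      rw [← Fin.sum_univ_eq_sum_range]
      exact Finset.sum_congr rfl fun j _ => by simp [g]
    rw [e1, e2]
    refine (Finset.sum_subset (Finset.range_subset_range.2 hN) fun j _ hj => ?_).symm
    exact dif_neg (by simpa using hj)
  · rw [dif_neg hk]
    split_ifs with hkN
    · refine Finset.sum_eq_zero fun j _ => ?_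
      simp [resize, hk]
    · rfl

lemma matrixCLM_sub (m m' : Matrix (Fin n) (Fin n) C) :
    matrixCLM (m - m') = matrixCLM m - matrixCLM m' :=
  congrArg Subtype.val (map_sub (matrixHom C n) (CStarMatrix.ofMatrix m) (CStarMatrix.ofMatrix m'))

lemma norm_matrixCLM_map_sub_le {n' : ℕ} (φ : A →⋆ₙₐ[ℂ] C) (m : Matrix (Fin n) (Fin n) A)
    (m' : Matrix (Fin n') (Fin n') A) :
    ‖matrixCLM (m.map φ) - matrixCLM (m'.map φ)‖ ≤ ‖matrixCLM m - matrixCLM m'‖ := by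
  -- `m` and `m'` may differ in size, so they are subtracted after padding with zeros.
  have h := norm_matrixCLM_map_le φ (resize (max n n') m - resize (max n n') m')
  have h1 : ∀ {k : ℕ} (p : Matrix (Fin k) (Fin k) A),
      (resize (max n n') p).map φ = resize (max n n') (p.map φ) := by
    intro k p
    ext i j
    simp only [resize, Matrix.map_apply, Matrix.of_apply]
    split_ifs <;> simp
  rw [Matrix.map_sub _ (fun a b => map_sub φ a b), matrixCLM_sub, matrixCLM_sub, h1, h1] at h
  simpa only [matrixCLM_resize (le_max_left n n'), matrixCLM_resize (le_max_right n n')] using h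

end MatrixOperators

/-! ### Diagonal operators -/

lemma exists_compPMap_precomp {E F G H : Type*} [AddCommGroup E] [Module ℂ E] [AddCommGroup F]
    [Module ℂ F] [AddCommGroup G] [Module ℂ G] [AddCommGroup H] [Module ℂ H] {f : F →ₗ.[ℂ] G}
    {T : E →ₗ[ℂ] F} (g : G →ₗ[ℂ] H) {x : E} {y : G} (h : (T x, y) ∈ f.graph) :
    ∃ hx : x ∈ (g.compPMap (precomp f T)).domain, g.compPMap (precomp f T) ⟨x, hx⟩ = g y := by
  obtain ⟨h1, h2⟩ := mk_mem_graph_iff.1 h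
  exact ⟨h1, congrArg g h2⟩

lemma exists_of_mem_compPMap_precomp {E F G H : Type*} [AddCommGroup E] [Module ℂ E]
    [AddCommGroup F] [Module ℂ F] [AddCommGroup G] [Module ℂ G] [AddCommGroup H] [Module ℂ H]
    {f : F →ₗ.[ℂ] G} {T : E →ₗ[ℂ] F} (g : G →ₗ[ℂ] H) (x : (g.compPMap (precomp f T)).domain) :
    ∃ y : G, (T x, y) ∈ f.graph ∧ g.compPMap (precomp f T) x = g y :=
  ⟨f ⟨T x, x.2⟩, mk_mem_graph_iff.2 ⟨x.2, rfl⟩, rfl⟩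

section Diagonal

variable {A B X Y : Type*}
  [NonUnitalCStarAlgebra A] [PartialOrder A] [StarOrderedRing A]
  [NonUnitalCStarAlgebra B] [PartialOrder B] [StarOrderedRing B]
  [NormedAddCommGroup X] [NormedSpace ℂ X] [SMul Aᵐᵒᵖ X] [CStarModule Aᵐᵒᵖ X]
  [NormedAddCommGroup Y] [NormedSpace ℂ Y] [SMul Bᵐᵒᵖ Y] [CStarModule Bᵐᵒᵖ Y]

lemma mem_graph_diag_iff {f : X →ₗ.[ℂ] Y} {x : StdMod A X} {y : StdMod B Y} :
    (x, y) ∈ (diag A B f).graph ↔ ∀ k, (x k, y k) ∈ f.graph := by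
  rw [mk_mem_graph_iff]
  constructor
  · rintro ⟨h, rfl⟩ k
    exact mk_mem_graph_iff.2 ⟨h.choose k, rfl⟩
  · intro h
    choose h1 h2 using fun k => mk_mem_graph_iff.1 (h k)
    have h3 : x ∈ (diag A B f).domain := ⟨h1, by
      simp only [h2]
      exact y.2⟩
    exact ⟨h3, StdMod.ext h2⟩

end Diagonal

/-! ### The domain of the derivation on the standard module -/

section Invariance

variable {A B Y : Type*}
  [NonUnitalCStarAlgebra A] [PartialOrder A] [StarOrderedRing A]
  [NonUnitalCStarAlgebra B] [PartialOrder B] [StarOrderedRing B]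
  [NormedAddCommGroup Y] [NormedSpace ℂ Y] [CompleteSpace Y] [SMul Bᵐᵒᵖ Y] [CStarModule Bᵐᵒᵖ Y]
  {D : Y →ₗ.[ℂ] Y} {ρ : A →⋆ₙₐ[ℂ] Adj B Y} {𝒜 : NonUnitalStarSubalgebra ℂ A}
  {δ : 𝒜 →ₗ[ℂ] Adj B Y}

/-- The sequence `{φ (a k)}` for a `⋆`-homomorphism `φ` and `a` in the standard module. -/
def StdMod.mapHom {C : Type*} [NonUnitalCStarAlgebra C] [PartialOrder C] [StarOrderedRing C]
    (φ : A →⋆ₙₐ[ℂ] C) (a : StdMod A A) : StdMod C C :=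
  ⟨fun k => φ (a k), by
    have h : (fun k => rinner C (φ (a k)) (φ (a k))) = fun k => φ (rinner A (a k) (a k)) := by
      funext k
      simp [rinner_self_def, map_star]
    change Summable _
    rw [h]
    have hφ : Continuous φ := AddMonoidHomClass.continuous_of_bound φ 1 fun a => by
      rw [one_mul]
      exact NonUnitalStarAlgHom.norm_apply_le φ a
    exact (StdMod.summable a a).map φ hφ⟩

lemma single_mem_diffStdMod (k : ℕ) (a : 𝒜) :
    StdMod.single A A k (a : A) ∈ diffStdMod δ := by
  obtain ⟨h, -⟩ : ∃ h : StdMod.single A A k (a : A) ∈ (diag A (Adj B Y) (derivClosure δ)).domain,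
      diag A (Adj B Y) (derivClosure δ) ⟨_, h⟩ =
        StdMod.single (Adj B Y) (Adj B Y) k (derivClosure δ ⟨a, coe_mem_derivClosure a⟩) := by
    rw [← mk_mem_graph_iff, mem_graph_diag_iff]
    intro n
    rw [StdMod.single_apply, StdMod.single_apply]
    split_ifs
    · exact LinearPMap.mem_graph _ ⟨(a : A), coe_mem_derivClosure a⟩
    · exact zero_mem _
  exact h

lemma dense_diffStdMod (h𝒜 : Dense (𝒜 : Set A)) :
    Dense (diffStdMod δ : Set (StdMod A A)) := by
  have h1 : ∀ k (a : A), StdMod.single A A k a ∈ (diffStdMod δ).topologicalClosure := by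
    intro k a
    have hcl : IsClosed {a : A | StdMod.single A A k a ∈ (diffStdMod δ).topologicalClosure} :=
      (Submodule.isClosed_topologicalClosure _).preimage (StdMod.single A A k).continuous
    refine closure_minimal (fun a ha => ?_) hcl (h𝒜 a)
    exact (diffStdMod δ).le_topologicalClosure (single_mem_diffStdMod k ⟨a, ha⟩)
  intro x
  refine (Submodule.isClosed_topologicalClosure (diffStdMod δ)).mem_of_tendsto
    (StdMod.hasSum_single x) (Filter.Eventually.of_forall fun s => ?_)
  exact Submodule.sum_mem _ fun k _ => h1 k (x k)

/-- A differentiable compact operator `T` maps `H_{A_δ}` into itself. For a finite matrix `m` this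
is the Leibniz rule `δ (m a) = δ(m) ρ(a) + ρ(m) δ(a)`, in which both summands converge as `m`
approaches `T`: the first by assumption, the second because `ρ` is contractive on matrices. -/
lemma map_mem_diffStdMod (hD : IsSelfAdjointOp B D)
    (hδ : ∀ a : 𝒜, IsCommutatorPair D ρ ((a : A), δ a))
    {T : StdMod A A →L[ℂ] StdMod A A} (hT : T ∈ diffCompactOps δ) {a : StdMod A A}
    (ha : a ∈ diffStdMod δ) : T a ∈ diffStdMod δ := by
  obtain ⟨⟨T, T'⟩, hp, rfl⟩ := hT
  obtain ⟨p, hp1, hp2⟩ := mem_closure_iff_seq_limit.1 hp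
  choose n m hm hm' using hp1
  obtain ⟨d, hd⟩ : ∃ d, (a, d) ∈ (diag A (Adj B Y) (derivClosure δ)).graph :=
    ⟨_, LinearPMap.mem_graph _ ⟨a, ha⟩⟩
  rw [mem_graph_diag_iff] at hd
  let R : ℕ → StdMod (Adj B Y) (Adj B Y) →L[ℂ] StdMod (Adj B Y) (Adj B Y) := fun l =>
    matrixCLM (((m l).map fun a => (a : A)).map ρ)
  have hp3 : Filter.Tendsto (fun l => (p l).1) Filter.atTop (nhds T) :=
    (continuous_fst.tendsto _).comp hp2
  have hp4 : Filter.Tendsto (fun l => (p l).2) Filter.atTop (nhds T') :=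
    (continuous_snd.tendsto _).comp hp2
  have hR : CauchySeq R := by
    have h1 := hp3.cauchySeq
    rw [Metric.cauchySeq_iff] at h1 ⊢
    intro ε hε
    obtain ⟨N, hN⟩ := h1 ε hε
    refine ⟨N, fun l hl l' hl' => lt_of_le_of_lt ?_ (hN l hl l' hl')⟩
    rw [dist_eq_norm, dist_eq_norm, (hm l).eq_matrixCLM, (hm l').eq_matrixCLM]
    exact norm_matrixCLM_map_sub_le ρ _ _
  obtain ⟨S, hS⟩ := cauchySeq_tendsto_of_complete hR
  let r := StdMod.mapHom ρ a
  have hgraph : ∀ l k, ((p l).1 a k, ((p l).2 r + R l d) k) ∈ (derivClosure δ).graph := by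
    intro l k
    rw [StdMod.add_apply, (hm l).eq_matrixCLM, (hm' l).eq_matrixCLM]
    simp only [R, matrixCLM_apply]
    split_ifs with hk
    · have h1 : ∀ j : Fin (n l), _ := fun j =>
        mul_mem_graph_derivClosure hD hδ (m l ⟨k, hk⟩ j) (hd j)
      have h2 := Submodule.sum_mem _ fun j (_ : j ∈ Finset.univ) => h1 j
      convert h2 using 1
      rw [← Finset.sum_add_distrib]
      exact Prod.ext (by rw [Prod.fst_sum]; rfl) (by rw [Prod.snd_sum]; rfl)
    · rw [add_zero]
      exact zero_mem _
  have hlim : ∀ k, (T a k, (T' r + S d) k) ∈ (derivClosure δ).graph := by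
    intro k
    have h1 : Filter.Tendsto (fun l => (p l).1 a k) Filter.atTop (nhds (T a k)) :=
      ((StdMod.proj A A k ∘L ContinuousLinearMap.apply ℂ _ a).continuous.tendsto T).comp hp3
    have h2 : Filter.Tendsto (fun l => ((p l).2 r + R l d) k) Filter.atTop
        (nhds ((T' r + S d) k)) :=
      ((StdMod.proj _ _ k).continuous.tendsto _).comp
        ((((ContinuousLinearMap.apply ℂ _ r).continuous.tendsto T').comp hp4).add
          (((ContinuousLinearMap.apply ℂ _ d).continuous.tendsto S).comp hS))
    exact (isClosed_graph_derivClosure hD hδ).mem_of_tendsto (h1.prodMk_nhds h2)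
      (Filter.Eventually.of_forall fun l => hgraph l k)
  exact (mk_mem_graph_iff.1 (mem_graph_diag_iff.2 hlim)).1

end Invariance

section Lift

variable {A B X Y : Type*}
  [NonUnitalCStarAlgebra A] [PartialOrder A] [StarOrderedRing A]
  [NonUnitalCStarAlgebra B] [PartialOrder B] [StarOrderedRing B]
  [NormedAddCommGroup X] [NormedSpace ℂ X] [CompleteSpace X] [SMul Aᵐᵒᵖ X] [CStarModule Aᵐᵒᵖ X]
  [NormedAddCommGroup Y] [NormedSpace ℂ Y] [CompleteSpace Y] [SMul Bᵐᵒᵖ Y] [CStarModule Bᵐᵒᵖ Y]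
  {D : Y →ₗ.[ℂ] Y} {ρ : A →⋆ₙₐ[ℂ] Adj B Y} {𝒜 : NonUnitalStarSubalgebra ℂ A}
  {δ : 𝒜 →ₗ[ℂ] Adj B Y} {W : AdjIsometry A X} {ζ : ℕ → X}

/-! ### Linearity and symmetry of the lift -/

/-- `diag D` is symmetric when `D` is selfadjoint. -/
lemma rinner_eq_of_mem_graph_diag (hD : IsSelfAdjointOp B D) {x y x' y' : StdMod B Y}
    (h : (x, y) ∈ (diag B B D).graph) (h' : (x', y') ∈ (diag B B D).graph) :
    rinner B y x' = rinner B x y' := by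
  rw [mem_graph_diag_iff] at h h'
  rw [StdMod.rinner_def, StdMod.rinner_def]
  exact tsum_congr fun k => hD.rinner_eq_of_mem_graph (h k) (h' k)

lemma isRightLinearOp_symLift (hD : IsSelfAdjointOp B D)
    (hζ : ∀ ξ k, W.toCLM ξ k = rinner A (ζ k) ξ) : IsRightLinearOp B (symLift ρ W D) := by
  intro σ b
  obtain ⟨y, hy, e⟩ := exists_of_mem_compPMap_precomp _ σ
  have hadj := AdjIsometry.isAdjointPair_tensorOne (ρ := ρ) hζ
  have h3 : (W.tensorOne ρ (op b • (σ : IntTensor X ρ)), op b • y) ∈ (diag B B D).graph := by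
    rw [hadj.map_act, mem_graph_diag_iff]
    exact fun k => hD.act_mem_graph (mem_graph_diag_iff.1 hy k) b
  obtain ⟨h, e'⟩ := exists_compPMap_precomp (adjointOf B (W.tensorOne ρ)).toLinearMap h3
  refine ⟨h, e'.trans ((hadj.symm.map_act b y).trans (congrArg (op b • ·) e.symm))⟩

lemma rinner_symLift (hD : IsSelfAdjointOp B D) (hζ : ∀ ξ k, W.toCLM ξ k = rinner A (ζ k) ξ)
    (σ τ : (symLift ρ W D).domain) :
    rinner B (symLift ρ W D σ) (τ : IntTensor X ρ) =
      rinner B (σ : IntTensor X ρ) (symLift ρ W D τ) := by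
  obtain ⟨y, hy, e⟩ := exists_of_mem_compPMap_precomp _ σ
  obtain ⟨y', hy', e'⟩ := exists_of_mem_compPMap_precomp _ τ
  have hadj := AdjIsometry.isAdjointPair_tensorOne (ρ := ρ) hζ
  have h1 : rinner B (symLift ρ W D σ) (τ : IntTensor X ρ) = rinner B y (W.tensorOne ρ τ) :=
    (congrArg (rinner B · (τ : IntTensor X ρ)) e).trans (hadj.symm _ _)
  have h2 : rinner B (σ : IntTensor X ρ) (symLift ρ W D τ) = rinner B (W.tensorOne ρ σ) y' :=
    (congrArg (rinner B (σ : IntTensor X ρ)) e').trans (hadj _ _).symm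
  rw [h1, h2]
  exact rinner_eq_of_mem_graph_diag hD hy hy'

/-! ### The Grassmann connection and the lift on elementary tensors -/

/-- A square summable sequence over `ℒ(Y)` with terms in `Ω_δ(A)` is square summable over
`Ω_δ(A)`. -/
lemma exists_incl_eq (d : StdMod (Adj B Y) (Adj B Y)) (hd : ∀ k, d k ∈ formsSubalgebra ρ δ) :
    ∃ ω : StdMod (Forms ρ δ) (Forms ρ δ), ∀ k, Forms.incl ρ δ (ω k) = d k := by
  let ω : ℕ → Forms ρ δ := fun k => ⟨d k, hd k⟩
  refine ⟨⟨ω, ?_⟩, fun k => rfl⟩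
  have h := StdMod.summable d d
  change Summable _
  rw [summable_iff_vanishing_norm] at h ⊢
  intro ε hε
  obtain ⟨s, hs⟩ := h ε hε
  refine ⟨s, fun t ht => lt_of_eq_of_lt ?_ (hs t ht)⟩
  change ‖Forms.incl ρ δ (∑ k ∈ t, rinner (Forms ρ δ) (ω k) (ω k))‖ = _
  rw [map_sum]
  rfl

lemma mem_graph_deriv_iff {a : A} {ω : Forms ρ δ} :
    (a, ω) ∈ (Forms.deriv ρ δ).graph ↔ (a, Forms.incl ρ δ ω) ∈ (derivClosure δ).graph := by
  rw [mk_mem_graph_iff, mk_mem_graph_iff]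
  exact exists_congr fun h => Subtype.ext_iff

/-- Evaluation at `η` intertwines the operators `W⋆ ⊗ 1` on `H_{Ω_δ(A)}` and on `Y^∞`, since both
are given by `{ω k} ↦ ∑ ζ k ⊗ ω k`. -/
lemma eval_adjointOf (h𝒜 : Dense (𝒜 : Set A)) (hζ : ∀ ξ k, W.toCLM ξ k = rinner A (ζ k) ξ)
    (ω : StdMod (Forms ρ δ) (Forms ρ δ)) (η : Y) :
    Forms.eval ρ δ h𝒜 η (adjointOf (Forms ρ δ) (W.tensorOne (Forms.rep ρ δ h𝒜)) ω) =
      adjointOf B (W.tensorOne ρ) (StdMod.applyVec (Forms.incl ρ δ) ω η) := by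
  have h1 := (AdjIsometry.hasSum_adjointOf_tensorOne (ρ := Forms.rep ρ δ h𝒜) hζ ω).mapL
    (Forms.eval ρ δ h𝒜 η)
  simp only [Forms.eval_tmul] at h1
  exact h1.unique (AdjIsometry.hasSum_adjointOf_tensorOne hζ
    (StdMod.applyVec (Forms.incl ρ δ) ω η))

variable {K : Adj A (StdMod A A)}

/-- The isometry `W` maps `𝒳` into `H_{A_δ}`, because `W W⋆ K²` is a differentiable compact
operator. -/
lemma map_mem_diffStdMod_of_mem_diffSubmodule (hD : IsSelfAdjointOp B D)
    (hδ : ∀ a : 𝒜, IsCommutatorPair D ρ ((a : A), δ a))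
    (hWK : IsDiffAbsorption δ W K) {ξ : X} (hξ : ξ ∈ diffSubmodule δ W K) :
    W.toCLM ξ ∈ diffStdMod δ := by
  obtain ⟨a, ha, rfl⟩ := hξ
  exact map_mem_diffStdMod hD hδ hWK.diff ha

lemma exists_symLift_tmul (hD : IsSelfAdjointOp B D)
    (hδ : ∀ a : 𝒜, IsCommutatorPair D ρ ((a : A), δ a))
    (h𝒜 : Dense (𝒜 : Set A)) (hζ : ∀ ξ k, W.toCLM ξ k = rinner A (ζ k) ξ) {ξ : X}
    (hξ : W.toCLM ξ ∈ diffStdMod δ) :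
    ∃ hξ : ξ ∈ (grassmann ρ δ h𝒜 W).domain,
      ∀ η : D.domain, ∃ h : IntTensor.tmul ρ ξ (η : Y) ∈ (symLift ρ W D).domain,
        symLift ρ W D ⟨IntTensor.tmul ρ ξ (η : Y), h⟩ =
          Forms.eval ρ δ h𝒜 (η : Y) (grassmann ρ δ h𝒜 W ⟨ξ, hξ⟩) +
            IntTensor.tmul ρ ξ (D η) := by
  obtain ⟨d, hd⟩ : ∃ d, (W.toCLM ξ, d) ∈ (diag A (Adj B Y) (derivClosure δ)).graph :=
    ⟨_, LinearPMap.mem_graph _ ⟨W.toCLM ξ, hξ⟩⟩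
  rw [mem_graph_diag_iff] at hd
  obtain ⟨ω, hω⟩ : ∃ ω : StdMod (Forms ρ δ) (Forms ρ δ), ∀ k, Forms.incl ρ δ (ω k) = d k := by
    refine exists_incl_eq d fun k => ?_
    obtain ⟨h, e⟩ := mk_mem_graph_iff.1 (hd k)
    rw [← e]
    exact ((Forms.deriv ρ δ) ⟨_, h⟩).2
  have hgr : (W.toCLM.toLinearMap ξ, ω) ∈ (diag A (Forms ρ δ) (Forms.deriv ρ δ)).graph := by
    rw [mem_graph_diag_iff]
    intro k
    rw [mem_graph_deriv_iff, hω]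
    exact hd k
  obtain ⟨hξ', e1⟩ := exists_compPMap_precomp
    (adjointOf (Forms ρ δ) (W.tensorOne (Forms.rep ρ δ h𝒜))).toLinearMap hgr
  refine ⟨hξ', fun η => ?_⟩
  have hgr' : ((W.tensorOne ρ).toLinearMap (IntTensor.tmul ρ ξ (η : Y)),
      StdMod.applyVec (Forms.incl ρ δ) ω (η : Y) + W.tensorOne ρ (IntTensor.tmul ρ ξ (D η))) ∈
        (diag B B D).graph := by
    rw [mem_graph_diag_iff]
    intro k
    obtain ⟨h, e⟩ := mk_mem_graph_iff.1 (hd k)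
    have hk := isCommutatorPair_derivClosure hD hδ ⟨_, h⟩ η
    rw [e] at hk
    rw [StdMod.add_apply, StdMod.applyVec_apply, hω, AdjIsometry.tensorOne_tmul]
    convert hk using 2
    exact W.tensorOne_tmul ρ ξ η k
  obtain ⟨h, e2⟩ := exists_compPMap_precomp (adjointOf B (W.tensorOne ρ)).toLinearMap hgr'
  refine ⟨h, e2.trans ?_⟩
  have e3 : grassmann ρ δ h𝒜 W ⟨ξ, hξ'⟩ =
      adjointOf (Forms ρ δ) (W.tensorOne (Forms.rep ρ δ h𝒜)) ω := e1
  rw [e3]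
  change adjointOf B (W.tensorOne ρ) (_ + _) = _
  rw [map_add, AdjIsometry.adjointOf_tensorOne_apply hζ, ← eval_adjointOf h𝒜 hζ]

/-! ### Density of the domain -/

/-- `W⋆ K² W = (W⋆ K W)²` has dense range, because `W W⋆` commutes with `K`. -/
lemma IsDiffAbsorption.dense_diffSubmodule (hWK : IsDiffAbsorption δ W K)
    (h𝒜 : Dense (𝒜 : Set A)) : Dense (diffSubmodule δ W K : Set X) := by
  have h1 : DenseRange (W.adj ∘L K.1 ∘L K.1 : StdMod A A →L[ℂ] X) := by
    refine (hWK.dense.comp hWK.dense (ContinuousLinearMap.continuous _)).mono ?_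
    rintro _ ⟨ξ, rfl⟩
    refine ⟨W.toCLM ξ, ?_⟩
    have h2 : K.1 (W.toCLM (W.adj (K.1 (W.toCLM ξ)))) =
        W.toCLM (W.adj (K.1 (K.1 (W.toCLM ξ)))) :=
      congrArg (fun T : StdMod A A →L[ℂ] StdMod A A => T (K.1 (W.toCLM ξ))) hWK.comm
    change W.adj (K.1 (K.1 (W.toCLM ξ))) = W.adj (K.1 (W.toCLM (W.adj (K.1 (W.toCLM ξ)))))
    rw [h2, W.adj_apply_apply]
  exact h1.dense_image (ContinuousLinearMap.continuous _) (dense_diffStdMod h𝒜)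

end Lift

end SymLift

end

theorem mainTheorem8
    {A B X Y : Type*}
    -- the C⋆-algebras `A` and `B`, with their usual orders
    [NonUnitalCStarAlgebra A] [PartialOrder A] [StarOrderedRing A]
    [NonUnitalCStarAlgebra B] [PartialOrder B] [StarOrderedRing B]
    -- the right Hilbert C⋆-modules `X` over `A` and `Y` over `B`
    [NormedAddCommGroup X] [NormedSpace ℂ X] [CompleteSpace X] [SMul Aᵐᵒᵖ X] [CStarModule Aᵐᵒᵖ X]
    [NormedAddCommGroup Y] [NormedSpace ℂ Y] [CompleteSpace Y] [SMul Bᵐᵒᵖ Y] [CStarModule Bᵐᵒᵖ Y]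
    -- the selfadjoint and regular operator `D`
    (D : Y →ₗ.[ℂ] Y) (hDsa : IsSelfAdjointOp B D) (hDreg : IsRegularOp B D)
    -- the representation `ρ`, the dense `⋆`-subalgebra `𝒜`, and `δ a`, extending `[D, ρ a]`
    (ρ : A →⋆ₙₐ[ℂ] Adj B Y) (hρ : Function.Injective ρ)
    (𝒜 : NonUnitalStarSubalgebra ℂ A) (h𝒜 : Dense (𝒜 : Set A))
    (δ : 𝒜 →ₗ[ℂ] Adj B Y)
    (hδ : ∀ (a : 𝒜) (η : D.domain), ∃ h : (ρ a).app η ∈ D.domain,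
      (δ a).app η = D ⟨(ρ a).app η, h⟩ - (ρ a).app (D η))
    -- generators of `X` with inner products in `𝒜`
    (x : ℕ → X) (hxgen : Dense (Submodule.span ℂ {z : X | ∃ (n : ℕ) (a : A), z = op a • x n} : Set X))
    (hx : ∀ n m, rinner A (x n) (x m) ∈ 𝒜)
    -- the pair `W`, `K` that defines `𝒳` and `∇_δ`, and a sequence implementing `W`
    (W : AdjIsometry A X) (K : Adj A (StdMod A A)) (hWK : IsDiffAbsorption δ W K)
    (ζ : ℕ → X) (hζ : ∀ ξ k, W.toCLM ξ k = rinner A (ζ k) ξ) :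
    -- the adjoints `W⋆ ⊗ 1` used for `1 ⊗_∇ D` and for `∇_δ` exist
    IsAdjointPair B (W.tensorOne ρ) (adjointOf B (W.tensorOne ρ)) ∧
    IsAdjointPair (Forms ρ δ) (W.tensorOne (Forms.rep ρ δ h𝒜))
      (adjointOf (Forms ρ δ) (W.tensorOne (Forms.rep ρ δ h𝒜))) ∧
    -- `1 ⊗_∇ D` is `B`-linear on a right submodule, densely defined and symmetric
    IsRightLinearOp B (symLift ρ W D) ∧
    IsSymmetricOp B (symLift ρ W D) ∧
    -- `(1 ⊗_∇ D) (ξ ⊗ η) = ∇_δ(ξ)(η) + ξ ⊗ D η`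
    ∀ ξ ∈ diffSubmodule δ W K, ∃ hξ : ξ ∈ (grassmann ρ δ h𝒜 W).domain,
      ∀ η : D.domain, ∃ h : IntTensor.tmul ρ ξ (η : Y) ∈ (symLift ρ W D).domain,
        symLift ρ W D ⟨IntTensor.tmul ρ ξ (η : Y), h⟩ =
          Forms.eval ρ δ h𝒜 (η : Y) (grassmann ρ δ h𝒜 W ⟨ξ, hξ⟩) +
            IntTensor.tmul ρ ξ (D η) := by
  have hcomm := isCommutatorPair_of_deriv hδ
  have hc := fun ξ (hξ : ξ ∈ diffSubmodule δ W K) => exists_symLift_tmul hDsa hcomm h𝒜 hζ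
    (map_mem_diffStdMod_of_mem_diffSubmodule hDsa hcomm hWK hξ)
  refine ⟨AdjIsometry.isAdjointPair_tensorOne hζ, AdjIsometry.isAdjointPair_tensorOne hζ,
    isRightLinearOp_symLift hDsa hζ, ⟨?_, rinner_symLift hDsa hζ⟩, hc⟩
  refine dense_of_tmul_mem _ (hWK.dense_diffSubmodule h𝒜) hDsa.1 fun ξ hξ η hη => ?_
  obtain ⟨_, h⟩ := hc ξ hξ
  exact (h ⟨η, hη⟩).1
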